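/- For an integer $m\ge 3$ let $P_m(x)=\frac{(m-2)x^2-(m-4)x}{2}$. A ternary $m$-gonal form is a polynomial $f(x_1,x_2,x_3)=a_1P_m(x_1)+a_2P_m(x_2)+a_3P_m(x_3)$ with positive integers $a_1,a_2,a_3$. An integer $n$ is represented by $f$ over a ring $R$ if $f(x_1,x_2,x_3)=n$ has a solution with $x_1,x_2,x_3\in R$. The form $f$ is called regular if it represents over $\mathbb{Z}$ every nonnegative integer that it represents over $\mathbb{R}$ and over $\mathbb{Z}_p$ for every prime $p$. Theorem. Let $m\ge 3$ be an integer for which there exists a regular ternary $m$-gonal form. Then $$ m\le \begin{cases} 35&\text{if } m\equiv 1 \pmod 2,\ m\equiv 2 \pmod 3,\\ 147&\text{if } m\equiv 1 \pmod 2,\ m\not\equiv 2 \pmod 3,\\ 38&\text{if } m\equiv 2 \pmod 4,\ m\equiv 2 \pmod 3,\\ 142&\text{if } m\equiv 2 \pmod 4,\ m\not\equiv 2 \pmod 3,\\ 188&\text{if } m\equiv 0 \pmod 4,\ m\equiv 2 \pmod 3,\\ 712&\text{if } m\equiv 0 \pmod 4,\ m\not\equiv 2 \pmod 3. \end{cases}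 $$ -/

import Mathlib

/-- The polynomial `P_m(x) = ((m - 2) x^2 - (m - 4) x) / 2`, evaluated in a field `K`.
All subtractions and the division take place in `K`. -/
def polygonal {K : Type*} [Field K] (m : ℕ) (x : K) : K :=
  (((m : K) - 2) * x ^ 2 - ((m : K) - 4) * x) / 2

/-- The integer `n` is represented over `R` by the `k`-ary `m`-gonal form
`a_1 P_m(x_1) + ... + a_k P_m(x_k)`: the equation `a_1 P_m(x_1) + ... + a_k P_m(x_k) = n` has a
solution with all `x_i` in `R`. The equation is read in a field `K` that contains `R`, because
`P_m` has rational coefficients. -/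
def RepresentedOver (R K : Type*) [CommRing R] [Field K] [Algebra R K]
    (m : ℕ) {k : ℕ} (a : Fin k → ℕ) (n : ℤ) : Prop :=
  ∃ x : Fin k → R, ∑ i, (a i : K) * polygonal m (algebraMap R K (x i)) = (n : K)

/-- `n` is represented over the ring of rational integers. -/
def Represented (m : ℕ) {k : ℕ} (a : Fin k → ℕ) (n : ℤ) : Prop :=
  RepresentedOver ℤ ℚ m a n

/-- `n` is represented over the `p`-adic integers for every prime `p`, and over the reals. -/
def LocallyRepresented (m : ℕ) {k : ℕ} (a : Fin k → ℕ) (n : ℤ) : Prop :=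
  (∀ (p : ℕ) [Fact p.Prime], RepresentedOver ℤ_[p] ℚ_[p] m a n) ∧ RepresentedOver ℝ ℝ m a n

/-- The `m`-gonal form with coefficients `a` represents every nonnegative integer that it
represents locally. -/
def IsRegularForm (m : ℕ) {k : ℕ} (a : Fin k → ℕ) : Prop :=
  ∀ n : ℤ, 0 ≤ n → LocallyRepresented m a n → Represented m a n

/-! Write `M = m - 2` and let `a ≤ b ≤ c` be the coefficients of a regular form, made primitive.

*Local input.* If a prime `p` divides `M` (and `4 ∣ M` when `p = 2`), then `P_m` is the identity
modulo `p` up to a quadratic term divisible by `p`, so by Hensel's lemma it maps `ℤ_p` onto itself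
and the form represents every integer over `ℤ_p`. At the other primes the rational points with
denominator `M` are `p`-integral (with a parity condition when `M ≡ 2 mod 4`). Hence every
nonnegative integer that the form takes at a point `(x₁, x₂, 0)` with `M x₁, M x₂ ∈ ℤ` is
represented over `ℤ`; this is `exists_regularAtFractions`.

*Contradiction.* Integral points take few small values: below `a (M - 1)` the form represents only
sums of distinct coefficients, and below `b (M - 1)` the last two variables are `0` or `1`. Suitable
fractional points in a class `(z₁ / M, z₂ / M)` modulo `1` take integral values in these ranges that
do not fit.

* If `a P_m` alone takes integral values at a class, then two or three of these are incompatible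
  with the short list (`false_of_single_class`). This happens if `M` (or `M / 2` for even `M`) is
  not a prime power, where the Chinese remainder theorem gives the class, and if the prime
  divides `a`.
* Otherwise a pair of classes with `a (z₁² - 1) + b (z₂² - 1) ≡ 0` is used. For `b / a` up to `8/5`
  the short list is violated directly; for `b / a` up to `5` there are three values no two of which
  can have the same third variable; for `b / a` up to `16` the pigeonhole principle applies to five
  shifts of `x₁`, two of which have the same `x₂, x₃ ∈ {0, 1}`. For larger `b / a`, three of
  nine shifts have the same `x₂, x₃ ∈ {0, 1}`, and two such coincidences give two short vectors of
  steps which are proportional modulo `M`, hence proportional, hence `z₁ = 1`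
  (`eq_one_of_three_coincidences`). The ranges are joined in `false_of_classes`.
* Such classes exist: for `M = p` or `2 p` as a point on the conic `a x² + b y² = a + b` modulo `p`
  that avoids few values of the coordinates (`false_of_prime`), for higher prime powers by moving
  `(1, 1)` by multiples of `M / p` (of `M / 4` for powers of `2`) in the first and of a smaller
  divisor of `M` in the second variable (`false_of_lift`). If `b` is divisible by almost the whole
  prime power, then `b P_m` alone takes integral values at fractions (`false_of_second_class`).

The numerical bounds of the theorem enter only through `false_of_large`: they make `M` large enough
whenever it is a prime power or twice a prime power. -/

/-! ### The values at integers, and one fractional variable -/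

/-- Twice the value `P_m(k)` of the polygonal polynomial at an integer `k`, where `M = m - 2`. -/
def gonal (M k : ℤ) : ℤ := M * k * (k - 1) + 2 * k

/-- The consequence of regularity on which the whole argument rests, for a form with coefficients
`a, b, c` and `M = m - 2`. An integer `w` stands for the rational point `x = (w - 1) / M`, at which
`2 M P_m(x) = (w - 1) (w - M + 1)`; the third variable is `0`. Every nonnegative integer that
such points represent has to be represented by integers. If `M ≡ 2 mod 4`, then the points have
to be `2`-integral, that is, `w` is odd. -/
def RegularAtFractions (M a b c : ℤ) : Prop :=
  ∀ w₁ w₂ n : ℤ, 0 ≤ n → (M % 4 = 2 → Odd w₁ ∧ Odd w₂) →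
    a * ((w₁ - 1) * (w₁ - M + 1)) + b * ((w₂ - 1) * (w₂ - M + 1)) = 2 * M * n →
    ∃ k₁ k₂ k₃ : ℤ, a * gonal M k₁ + b * gonal M k₂ + c * gonal M k₃ = 2 * n

lemma gonal_nonneg {M : ℤ} (hM : 3 ≤ M) (k : ℤ) : 0 ≤ gonal M k := by
  unfold gonal
  rcases le_or_gt k 0 with h | h
  · nlinarith [mul_nonneg (neg_nonneg.2 h) (neg_nonneg.2 h)]
  · nlinarith [mul_nonneg (by omega : 0 ≤ k) (by omega : 0 ≤ k - 1)]

lemma le_gonal {M : ℤ} (hM : 3 ≤ M) {k : ℤ} (h0 : k ≠ 0) (h1 : k ≠ 1) :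
    2 * (M - 1) ≤ gonal M k := by
  unfold gonal
  rcases lt_or_gt_of_ne h0 with h | h
  · have h2 : 0 ≤ -1 - k := by omega
    nlinarith [mul_nonneg h2 h2, mul_nonneg (by omega : (0:ℤ) ≤ M - 3) (mul_nonneg h2 h2)]
  · have h2 : 0 ≤ k - 2 := by omega
    nlinarith [mul_nonneg h2 h2, mul_nonneg (by omega : (0:ℤ) ≤ M - 3) (mul_nonneg h2 h2)]

lemma eq_zero_or_one_of_gonal_lt {M a n k s : ℤ} (hM : 3 ≤ M) (ha : 0 < a)
    (hn : n < a * (M - 1)) (hs : 0 ≤ s) (h : a * gonal M k + s = 2 * n) : k = 0 ∨ k = 1 := by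
  by_contra hk
  push Not at hk
  have := mul_le_mul_of_nonneg_left (le_gonal hM hk.1 hk.2) ha.le
  linarith

/-- A represented number below `b (M - 1)` uses only the values `0` and `1` of the last two
variables. -/
lemma exists_gonal_of_lt {M a b c n k₁ k₂ k₃ : ℤ} (hM : 3 ≤ M) (ha : 0 < a) (hab : a ≤ b)
    (hbc : b ≤ c) (hn : n < b * (M - 1))
    (h : a * gonal M k₁ + b * gonal M k₂ + c * gonal M k₃ = 2 * n) :
    ∃ k s : ℤ, (s = 0 ∨ s = b ∨ s = c ∨ s = b + c) ∧ 2 * n = a * gonal M k + 2 * s := by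
  have e1 := mul_nonneg ha.le (gonal_nonneg hM k₁)
  have e2 := mul_nonneg (by omega : 0 ≤ b) (gonal_nonneg hM k₂)
  have e3 := mul_nonneg (by omega : 0 ≤ c) (gonal_nonneg hM k₃)
  have h2 : k₂ = 0 ∨ k₂ = 1 :=
    eq_zero_or_one_of_gonal_lt hM (by omega : 0 < b) hn (add_nonneg e1 e3) (by linarith)
  have hn' : n < c * (M - 1) := lt_of_lt_of_le hn (by nlinarith)
  have h3 : k₃ = 0 ∨ k₃ = 1 :=
    eq_zero_or_one_of_gonal_lt hM (by omega : 0 < c) hn' (add_nonneg e1 e2) (by linarith)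
  rcases h2 with rfl | rfl <;> rcases h3 with rfl | rfl
  · exact ⟨k₁, 0, by simp, by rw [← h]; simp [gonal]⟩
  · exact ⟨k₁, c, by simp, by rw [← h]; simp [gonal]; ring⟩
  · exact ⟨k₁, b, by simp, by rw [← h]; simp [gonal]; ring⟩
  · exact ⟨k₁, b + c, by simp, by rw [← h]; simp [gonal]; ring⟩

/-- A represented number below `a (M - 1)` is a sum of distinct coefficients. -/
lemma subset_sum_of_lt {M a b c n k₁ k₂ k₃ : ℤ} (hM : 3 ≤ M) (ha : 0 < a) (hab : a ≤ b)
    (hbc : b ≤ c) (hn : n < a * (M - 1))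
    (h : a * gonal M k₁ + b * gonal M k₂ + c * gonal M k₃ = 2 * n) :
    ∃ s : ℤ, (s = 0 ∨ s = b ∨ s = c ∨ s = b + c) ∧ (n = s ∨ n = a + s) := by
  obtain ⟨k, s, hs, hk⟩ := exists_gonal_of_lt hM ha hab hbc
    (lt_of_lt_of_le hn (by nlinarith)) h
  have hs0 : 0 ≤ s := by omega
  refine ⟨s, hs, ?_⟩
  rcases eq_zero_or_one_of_gonal_lt hM ha hn (by omega : 0 ≤ 2 * s) hk.symm with rfl | rfl
  · left; simp [gonal] at hk; linarith
  · right; simp [gonal] at hk; linarith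

/-- A represented number below `a (M - 1)` is a sum of some of `a`, `b`, or it lies within `a + b`
above `c`. -/
lemma near_zero_or_near_of_lt {M a b c n k₁ k₂ k₃ : ℤ} (hM : 3 ≤ M) (ha : 0 < a) (hab : a ≤ b)
    (hbc : b ≤ c) (hn : n < a * (M - 1))
    (h : a * gonal M k₁ + b * gonal M k₂ + c * gonal M k₃ = 2 * n) :
    n = 0 ∨ n = a ∨ n = b ∨ n = a + b ∨ (c ≤ n ∧ n ≤ a + b + c) := by
  obtain ⟨s, hs, hn⟩ := subset_sum_of_lt hM ha hab hbc hn h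
  omega

/-- Regularity fails if one variable alone takes integral multiples of `1 / a` at a suitable
class `t / M` modulo `1`. -/
lemma false_of_single_class {M a b c t q : ℤ} (hM : 39 ≤ M) (ha : 0 < a) (hab : a ≤ b)
    (hbc : b ≤ c) (H : RegularAtFractions M a b c) (ht : 2 ≤ t) (htM : 2 * t ≤ M - 4)
    (hlow : M ≤ t * (t + 2)) (hpar : M % 4 = 2 → Even t) (hq : 2 * M * q = a * (t * (M - 2 - t))) :
    False := by
  have hM3 : 3 ≤ M := by omega
  -- the values at `t / M`, `t / M + 1` and `t / M - 1`
  have val : ∀ n j e : ℤ, (j = 0 ∧ n = -q ∨ j = 1 ∧ n = -q + a * (t + 1) ∨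
      j = -1 ∧ n = -q + a * (M - 1 - t)) → (e = 0 ∨ e = 1) → 0 ≤ n + e * b →
      n + e * b < a * (M - 1) →
      n + e * b = 0 ∨ n + e * b = a ∨ n + e * b = b ∨ n + e * b = a + b ∨
        (c ≤ n + e * b ∧ n + e * b ≤ a + b + c) := by
    intro n j e hj he h0 h1
    have hw : ∃ w : ℤ, (M % 4 = 2 → Odd w) ∧ a * ((w - 1) * (w - M + 1)) = 2 * M * n := by
      refine ⟨1 + t + j * M, fun h4 => ?_, ?_⟩
      · obtain ⟨t', ht'⟩ := hpar h4
        obtain ⟨M', hM'⟩ : ∃ M', M = 2 * M' := ⟨M / 2, by omega⟩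
        exact ⟨t' + j * M', by rw [ht', hM']; ring⟩
      · rcases hj with ⟨rfl, rfl⟩ | ⟨rfl, rfl⟩ | ⟨rfl, rfl⟩ <;> linear_combination hq
    have hv : ∃ w : ℤ, (M % 4 = 2 → Odd w) ∧ b * ((w - 1) * (w - M + 1)) = 2 * M * (e * b) := by
      refine ⟨1 + e * M, fun h4 => ?_, ?_⟩
      · obtain ⟨M', hM'⟩ : ∃ M', M = 2 * M' := ⟨M / 2, by omega⟩
        exact ⟨e * M', by rw [hM']; ring⟩
      · rcases he with rfl | rfl <;> ring
    obtain ⟨w, hw1, hw2⟩ := hw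
    obtain ⟨v, hv1, hv2⟩ := hv
    obtain ⟨k₁, k₂, k₃, hk⟩ := H w v (n + e * b) h0 (fun h => ⟨hw1 h, hv1 h⟩)
      (by rw [hw2, hv2]; ring)
    exact near_zero_or_near_of_lt hM3 ha hab hbc h1 hk
  have hqpos : 0 < q := by
    have : 0 < a * (t * (M - 2 - t)) := by
      have : 0 < t * (M - 2 - t) := mul_pos (by omega) (by omega)
      positivity
    by_contra hneg
    have : 2 * M * q ≤ 0 := mul_nonpos_of_nonneg_of_nonpos (by omega) (by omega)
    omega
  -- `2 q = a t - a t (t + 2) / M`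
  have hqle : M * (2 * q) ≤ M * (a * (t - 1)) := by
    have := mul_le_mul_of_nonneg_left hlow ha.le
    nlinarith
  have hqle' : 2 * q ≤ a * (t - 1) := le_of_mul_le_mul_left hqle (by omega)
  have ht1 : a * 1 ≤ a * (t - 1) := mul_le_mul_of_nonneg_left (by omega) ha.le
  have hN1 : -q + a * (t + 1) = (-q + a * (t - 1)) + 2 * a := by ring
  have hbig : a * (M - 1) = a * (t + 1) + a * (M - 1 - t) - a := by ring
  have h21 : a * (M - 1 - t) - a * (t + 1) = a * (M - 2 - 2 * t) := by ring
  have h21' : a * 2 ≤ a * (M - 2 - 2 * t) := mul_le_mul_of_nonneg_left (by omega) ha.le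
  have v1 := val (-q + a * (t + 1)) 1 0 (by simp) (by simp) (by linarith) (by linarith)
  have hb1 : b ≤ -q + a * (t + 1) := by
    simp only [zero_mul, add_zero] at v1
    omega
  have hbq : b ≤ q + a := by
    rcases le_or_gt q b with h | h
    · have := val (-q) 0 1 (by simp) (by simp) (by linarith) (by linarith)
      simp only [one_mul] at this
      omega
    · linarith
  have v2 := val (-q + a * (M - 1 - t)) (-1) 1 (by simp) (by simp) (by linarith) (by linarith)
  simp only [one_mul] at v2
  rcases eq_or_lt_of_le hlow with heq | hlt
  · -- here `M = t (t + 2)` and the two positive values are far apart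
    have v3 := val (-q + a * (t + 1)) 1 1 (by simp) (by simp) (by linarith) (by linarith)
    simp only [one_mul] at v3
    have h5 : 5 ≤ t := by nlinarith
    have : a * (t + 3) ≤ a * (M - 2 - 2 * t) := mul_le_mul_of_nonneg_left (by nlinarith) ha.le
    have e1 : a * (t + 3) = a * (t - 1) + 4 * a := by ring
    omega
  · have hqlt : M * (2 * q) < M * (a * (t - 1)) := by
      have := mul_lt_mul_of_pos_left hlt ha
      nlinarith
    have hqlt' : 2 * q < a * (t - 1) := lt_of_mul_lt_mul_left hqlt (by omega)
    simp only [zero_mul, add_zero] at v1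
    have e1 : a * (t + 1) = a * (t - 1) + 2 * a := by ring
    omega

/-! ### Coincidences of values in a fixed class -/

/-- The larger of `|l|` and `|l + 1|`, which bounds `|x + l|` for `0 ≤ x ≤ 1`. -/
def shiftBound (l : ℤ) : ℤ := max |l| |l + 1|

lemma abs_add_mul_le_interpolate {M z l : ℤ} (hz : 0 < z) (hzM : 2 * z < M) :
    |2 * z + l * M| ≤ (M - 2 * z) * |l| + 2 * z * |l + 1| := by
  have h := abs_add_le ((M - 2 * z) * l) (2 * z * (l + 1))
  rw [abs_mul, abs_mul, abs_of_pos (by omega : 0 < M - 2 * z),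
    abs_of_pos (by omega : 0 < 2 * z)] at h
  calc |2 * z + l * M| = |(M - 2 * z) * l + 2 * z * (l + 1)| := by congr 1; ring
    _ ≤ _ := h

lemma abs_add_mul_le {M z l : ℤ} (hz : 0 < z) (hzM : 2 * z < M) :
    |2 * z + l * M| ≤ shiftBound l * M := by
  have h1 : (M - 2 * z) * |l| ≤ (M - 2 * z) * shiftBound l :=
    mul_le_mul_of_nonneg_left (le_max_left _ _) (by omega)
  have h2 : 2 * z * |l + 1| ≤ 2 * z * shiftBound l :=
    mul_le_mul_of_nonneg_left (le_max_right _ _) (by omega)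
  have := abs_add_mul_le_interpolate (l := l) hz hzM
  linarith

lemma two_mul_add_ne_zero {M z l : ℤ} (hz : 0 < z) (hzM : 2 * z < M) : 2 * z + l * M ≠ 0 := by
  intro h
  rcases lt_trichotomy l (-1) with hl | rfl | hl
  · nlinarith
  · omega
  · nlinarith [mul_nonneg (by omega : 0 ≤ l) (by omega : 0 ≤ M)]

/-- `|e M + 2| ≥ |e| (M - 2)`. -/
lemma abs_mul_sub_two_le {M e : ℤ} : |e| * (M - 2) ≤ |e * M + 2| := by
  rcases lt_trichotomy e 0 with h | rfl | h
  · rw [abs_of_neg h]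
    have := neg_le_abs (e * M + 2)
    nlinarith
  · simp
  · rw [abs_of_pos h]
    have := le_abs_self (e * M + 2)
    nlinarith

/-- Two equal values `2 z j + M j (j - 1) - gonal M k`, in factored form and modulo `M`. -/
lemma pair_eq {M z j k j' k' : ℤ}
    (h : 2 * z * j + M * (j * (j - 1)) - gonal M k =
      2 * z * j' + M * (j' * (j' - 1)) - gonal M k') :
    (j' - j) * (2 * z + (j + j' - 1) * M) = (k' - k) * ((k + k' - 1) * M + 2) ∧
      ∃ u, (j' - j) * z - (k' - k) = M * u := by
  have h1 : (j' - j) * (2 * z + (j + j' - 1) * M) = (k' - k) * ((k + k' - 1) * M + 2) := by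
    unfold gonal at h
    linear_combination -h
  refine ⟨h1, ?_⟩
  obtain ⟨J, hJ⟩ : ∃ J, (j' - j) * (j + j' - 1) = 2 * J := by
    obtain ⟨x, hx⟩ := (Int.even_mul_succ_self (j - 1)).two_dvd
    obtain ⟨y, hy⟩ := (Int.even_mul_succ_self (j' - 1)).two_dvd
    exact ⟨y - x, by linear_combination hy - hx⟩
  obtain ⟨K, hK⟩ : ∃ J, (k' - k) * (k + k' - 1) = 2 * J := by
    obtain ⟨x, hx⟩ := (Int.even_mul_succ_self (k - 1)).two_dvd
    obtain ⟨y, hy⟩ := (Int.even_mul_succ_self (k' - 1)).two_dvd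
    exact ⟨y - x, by linear_combination hy - hx⟩
  refine ⟨K - J, ?_⟩
  have : 2 * ((j' - j) * z - (k' - k)) = 2 * (M * (K - J)) := by
    linear_combination h1 + M * hK - M * hJ
  linarith

lemma diff_ne_zero {M z j k j' k' : ℤ} (hz : 0 < z) (hzM : 2 * z < M) (hj : j' ≠ j)
    (h : (j' - j) * (2 * z + (j + j' - 1) * M) = (k' - k) * ((k + k' - 1) * M + 2)) :
    k' - k ≠ 0 := by
  intro h0
  rw [h0, zero_mul] at h
  rcases mul_eq_zero.1 h with h | h
  · omega
  · exact two_mul_add_ne_zero hz hzM h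

/-- Unless `k` and `k'` are mirror images of each other, that is, `k + k' = 1`, this bounds their
distance essentially by `X`. -/
lemma diff_mul_le {M z j k j' k' X : ℤ} (hM : 3 ≤ M) (hz : 0 < z) (hzM : 2 * z < M)
    (hj : j < j') (hX : (j' - j) * shiftBound (j + j' - 1) ≤ X)
    (h : (j' - j) * (2 * z + (j + j' - 1) * M) = (k' - k) * ((k + k' - 1) * M + 2)) :
    |k' - k| * |k + k' - 1| * (M - 2) ≤ X * M := by
  have e1 := congrArg abs h
  rw [abs_mul, abs_mul, abs_of_pos (by omega : 0 < j' - j)] at e1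
  have e2 := mul_le_mul_of_nonneg_left (abs_mul_sub_two_le (M := M) (e := k + k' - 1))
    (abs_nonneg (k' - k))
  have e3 := mul_le_mul_of_nonneg_left (abs_add_mul_le (l := j + j' - 1) hz hzM)
    (by omega : 0 ≤ j' - j)
  have e4 := mul_le_mul_of_nonneg_right hX (by omega : 0 ≤ M)
  nlinarith

lemma le_of_mul_sub_two_le {M x X : ℤ} (hX : 2 * X + 2 < M) (hM : 3 ≤ M)
    (h : x * (M - 2) ≤ X * M) : x ≤ X := by
  by_contra hx
  push Not at hx
  nlinarith [mul_le_mul_of_nonneg_right (by omega : X + 1 ≤ x) (by omega : 0 ≤ M - 2)]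

lemma shiftBound_pair : ∀ j ∈ Finset.Icc (-4 : ℤ) 4, ∀ j' ∈ Finset.Icc (-4 : ℤ) 4, j < j' →
    (j' - j) * shiftBound (j + j' - 1) ≤ 20 ∧
    (j' - j) + (j' - j) * shiftBound (j + j' - 1) ≤ 25 ∧
    (j' - j) * ((j' - j) * shiftBound (j + j' - 1)) + (j' - j) ≤ 114 := by
  unfold shiftBound
  decide

/-- The bound `128` for the determinant of the steps, in units of `M / (M - 2)`, is the reason for
the assumption `M ≥ 131` below. -/
lemma step_mul_abs_le : ∀ j₁ ∈ Finset.Icc (-4 : ℤ) 4, ∀ j₂ ∈ Finset.Icc (-4 : ℤ) 4,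
    ∀ j₃ ∈ Finset.Icc (-4 : ℤ) 4, j₁ < j₂ → j₂ < j₃ →
    (j₂ - j₁) * (j₃ - j₂) * (|j₁ + j₂ - 1| + |j₂ + j₃ - 1|) ≤ 128 ∧
    (j₂ - j₁) * (j₃ - j₂) * (|j₁ + j₂ - 1 + 1| + |j₂ + j₃ - 1 + 1|) ≤ 128 := by
  decide

/-- If the steps `j' - j` and `k' - k` are equal, then the class is `1 / M` and the
parametrisations agree. -/
lemma eq_one_of_diff_eq {M z j k j' k' : ℤ} (hz : 0 < z) (hzM : 2 * z < M) (hj : j < j')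
    (hd : k' - k = j' - j)
    (h : (j' - j) * (2 * z + (j + j' - 1) * M) = (k' - k) * ((k + k' - 1) * M + 2)) :
    z = 1 ∧ k = j := by
  rw [hd] at h
  have h1 := mul_left_cancel₀ (by omega : j' - j ≠ 0) h
  have h2 : z - 1 = M * (k - j) := by
    have : k' = k + (j' - j) := by omega
    subst this
    have : 2 * (z - 1) = 2 * (M * (k - j)) := by linear_combination h1
    linarith
  have h3 : k - j = 0 := by
    by_contra hne
    rcases lt_or_gt_of_ne hne with h4 | h4 <;> nlinarith
  rw [h3] at h2
  exact ⟨by linarith, by linarith⟩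

/-- A mirrored pair and a third point: the determinant of the steps is small. Here `a`, `b` stand
for the steps from the mirrored points to the third one. -/
lemma mirror_det_lt {M G β X a b : ℤ} (hβ : 0 < β) (hβG : β ≤ G) (hM : G * X + G ≤ 114)
    (hM' : 131 ≤ M) (hX : X ≤ 20) (ha : a ≠ 0) (hb : b ≠ 0)
    (h : |a| * |b| * (M - 2) ≤ X * M) : |G * b - β * a| < M := by
  have h1 := le_of_mul_sub_two_le (by omega) (by omega) h
  have ha' := abs_pos.2 ha
  have hb' := abs_pos.2 hb
  have h2 : |a| + |b| ≤ X + 1 := by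
    nlinarith [mul_nonneg (by omega : 0 ≤ |a| - 1) (by omega : 0 ≤ |b| - 1)]
  have h3 : |G * b - β * a| ≤ G * |b| + β * |a| := by
    have := abs_sub (G * b) (β * a)
    rwa [abs_mul, abs_mul, abs_of_pos hβ, abs_of_pos (by omega : 0 < G)] at this
  have h4 : β * |a| ≤ β + G * (|a| - 1) := by
    nlinarith [mul_le_mul_of_nonneg_right hβG (by omega : 0 ≤ |a| - 1)]
  have h5 := mul_le_mul_of_nonneg_left h2 (by omega : 0 ≤ G)
  nlinarith

lemma eq_zero_of_abs_lt_of_eq_mul {M D u : ℤ} (h : |D| < M) (hu : D = M * u) : D = 0 :=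
  Int.eq_zero_of_abs_lt_dvd ⟨u, hu⟩ h

/-- The determinant of the steps vanishes only if the steps agree. -/
lemma diff_eq_of_det_eq_zero {M z j₁ j₂ j₃ k₁ k₂ k₃ : ℤ} (hM : 3 ≤ M) (h12 : j₁ < j₂)
    (h23 : j₂ < j₃)
    (e12 : (j₂ - j₁) * (2 * z + (j₁ + j₂ - 1) * M) = (k₂ - k₁) * ((k₁ + k₂ - 1) * M + 2))
    (e23 : (j₃ - j₂) * (2 * z + (j₂ + j₃ - 1) * M) = (k₃ - k₂) * ((k₂ + k₃ - 1) * M + 2))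
    (hu : ∃ u, (j₂ - j₁) * z - (k₂ - k₁) = M * u) (hzM : 2 * z < M) (hz : 0 < z)
    (hD : (j₂ - j₁) * (k₃ - k₂) - (j₃ - j₂) * (k₂ - k₁) = 0) : k₂ - k₁ = j₂ - j₁ := by
  obtain ⟨α, hα⟩ : ∃ α, α = j₂ - j₁ := ⟨_, rfl⟩
  obtain ⟨β, hβ⟩ : ∃ β, β = j₃ - j₂ := ⟨_, rfl⟩
  obtain ⟨p, hp⟩ : ∃ p, p = k₂ - k₁ := ⟨_, rfl⟩
  obtain ⟨q, hq⟩ : ∃ q, q = k₃ - k₂ := ⟨_, rfl⟩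
  obtain rfl : j₂ = j₁ + α := by omega
  obtain rfl : j₃ = j₁ + α + β := by omega
  obtain rfl : k₂ = k₁ + p := by omega
  obtain rfl : k₃ = k₁ + p + q := by omega
  have hα0 : 0 < α := by omega
  have hβ0 : 0 < β := by omega
  have hD' : α * q = β * p := by linear_combination hD
  have f : (α * M) * (β * (α + β)) = (α * M) * (q * (p + q)) := by
    linear_combination α * e23 - β * e12 +
      (2 + M * (2 * k₁ + p - 1)) * hD'
  have f1 : β * (α + β) = q * (p + q) :=
    mul_left_cancel₀ (mul_ne_zero hα0.ne' (by omega)) f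
  have f2 : (β * (α + β)) * (α * α) = (β * (α + β)) * (p * p) := by
    linear_combination α * α * f1 + (α * (p + q) + β * p) * hD'
  have f3 : α * α = p * p :=
    mul_left_cancel₀ (mul_ne_zero hβ0.ne' (by omega)) f2
  rcases mul_self_eq_mul_self_iff.1 f3 with h | h
  · omega
  · exfalso
    obtain rfl : p = -α := by omega
    have g1 : α * (2 * z + (2 * j₁ + α - 1) * M + (2 * k₁ - α - 1) * M + 2) = 0 := by
      linear_combination e12
    have g2 := (mul_eq_zero.1 g1).resolve_left hα0.ne'
    have g3 : z + 1 = M * (1 - j₁ - k₁) := by linarith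
    have : 0 < 1 - j₁ - k₁ := by
      by_contra hn
      nlinarith
    nlinarith

/-- Among the values of a class `z / M` modulo `1`, three at distance at most `8` of each other
agree, up to one constant, with values at integers only if the class is that of `1 / M`. The reason
is that two such coincidences determine two vectors of steps that are proportional modulo `M` and
short, so that they are proportional. -/
lemma eq_one_of_three_coincidences {M z κ j₁ j₂ j₃ k₁ k₂ k₃ : ℤ}
    (hM : 131 ≤ M ∨ (M = 81 ∧ (z = 1 ∨ z = 28))) (hz : 0 < z) (hzM : 2 * z < M)
    (hj₁ : -4 ≤ j₁) (h12 : j₁ < j₂) (h23 : j₂ < j₃) (hj₃ : j₃ ≤ 4)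
    (e₁ : 2 * z * j₁ + M * (j₁ * (j₁ - 1)) - gonal M k₁ = κ)
    (e₂ : 2 * z * j₂ + M * (j₂ * (j₂ - 1)) - gonal M k₂ = κ)
    (e₃ : 2 * z * j₃ + M * (j₃ * (j₃ - 1)) - gonal M k₃ = κ) : z = 1 ∧ κ = 0 := by
  have m₁ : j₁ ∈ Finset.Icc (-4 : ℤ) 4 := Finset.mem_Icc.2 (by omega)
  have m₂ : j₂ ∈ Finset.Icc (-4 : ℤ) 4 := Finset.mem_Icc.2 (by omega)
  have m₃ : j₃ ∈ Finset.Icc (-4 : ℤ) 4 := Finset.mem_Icc.2 (by omega)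
  obtain ⟨p12, u12, hu12⟩ := pair_eq (e₁.trans e₂.symm)
  obtain ⟨p23, u23, hu23⟩ := pair_eq (e₂.trans e₃.symm)
  obtain ⟨p13, u13, hu13⟩ := pair_eq (e₁.trans e₃.symm)
  have n12 := diff_ne_zero hz hzM (by omega) p12
  have n23 := diff_ne_zero hz hzM (by omega) p23
  have n13 := diff_ne_zero hz hzM (by omega) p13
  have fin : ∀ {j k j' k' : ℤ}, j < j' → k' - k = j' - j →
      (j' - j) * (2 * z + (j + j' - 1) * M) = (k' - k) * ((k + k' - 1) * M + 2) →
      2 * z * j + M * (j * (j - 1)) - gonal M k = κ → z = 1 ∧ κ = 0 := by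
    intro j k j' k' hj hd h he
    obtain ⟨rfl, rfl⟩ := eq_one_of_diff_eq hz hzM hj hd h
    refine ⟨rfl, ?_⟩
    rw [← he]
    unfold gonal
    ring
  obtain ⟨s12, s12', s12''⟩ := shiftBound_pair j₁ m₁ j₂ m₂ h12
  obtain ⟨s23, s23', s23''⟩ := shiftBound_pair j₂ m₂ j₃ m₃ h23
  obtain ⟨s13, s13', s13''⟩ := shiftBound_pair j₁ m₁ j₃ m₃ (h12.trans h23)
  rcases hM with hM | ⟨rfl, hz'⟩
  · refine fin h12 (diff_eq_of_det_eq_zero (by omega) h12 h23 p12 p23 ⟨u12, hu12⟩ hzM hz ?_)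
      p12 e₁
    have hdiv : (j₂ - j₁) * (k₃ - k₂) - (j₃ - j₂) * (k₂ - k₁) =
        M * ((j₃ - j₂) * u12 - (j₂ - j₁) * u23) := by
      linear_combination (j₃ - j₂) * hu12 - (j₂ - j₁) * hu23
    refine eq_zero_of_abs_lt_of_eq_mul ?_ hdiv
    -- the cases that the first two, or the last two, points are mirrored
    by_cases z12 : k₁ + k₂ - 1 = 0
    · have := diff_mul_le (by omega) hz hzM (h12.trans h23) le_rfl p13
      rw [show k₁ + k₃ - 1 = k₃ - k₂ by omega] at this
      have := mirror_det_lt (G := j₃ - j₁) (β := j₃ - j₂) (by omega) (by omega) (by linarith)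
        hM s13 n13 n23 this
      convert this using 2
      ring
    by_cases z23 : k₂ + k₃ - 1 = 0
    · have := diff_mul_le (by omega) hz hzM (h12.trans h23) le_rfl p13
      rw [show k₁ + k₃ - 1 = -(k₂ - k₁) by omega, abs_neg] at this
      have := mirror_det_lt (G := j₃ - j₁) (β := j₂ - j₁) (by omega) (by omega) (by linarith)
        hM s13 n13 n12 this
      rw [← abs_neg]
      convert this using 2
      ring
    have drop : ∀ {j k j' k' : ℤ}, j < j' → k + k' - 1 ≠ 0 →
        (j' - j) * (2 * z + (j + j' - 1) * M) = (k' - k) * ((k + k' - 1) * M + 2) →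
        |k' - k| * (M - 2) ≤
          (j' - j) * ((M - 2 * z) * |j + j' - 1| + 2 * z * |j + j' - 1 + 1|) := by
      intro j k j' k' hj hne h
      have e1 := congrArg abs h
      rw [abs_mul, abs_mul, abs_of_pos (by omega : 0 < j' - j)] at e1
      have e2 := mul_le_mul_of_nonneg_left (abs_add_mul_le_interpolate (l := j + j' - 1) hz hzM)
        (by omega : 0 ≤ j' - j)
      have e3 : M - 2 ≤ |k + k' - 1| * (M - 2) :=
        le_mul_of_one_le_left (by omega) (abs_pos.2 hne)
      have e4 := mul_le_mul_of_nonneg_left (e3.trans abs_mul_sub_two_le) (abs_nonneg (k' - k))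
      linarith
    have c12 := drop h12 z12 p12
    have c23 := drop h23 z23 p23
    obtain ⟨hs, hs'⟩ := step_mul_abs_le j₁ m₁ j₂ m₂ j₃ m₃ h12 h23
    have d1 := abs_sub ((j₂ - j₁) * (k₃ - k₂)) ((j₃ - j₂) * (k₂ - k₁))
    rw [abs_mul, abs_mul, abs_of_pos (by omega : 0 < j₂ - j₁),
      abs_of_pos (by omega : 0 < j₃ - j₂)] at d1
    have d2 : |(j₂ - j₁) * (k₃ - k₂) - (j₃ - j₂) * (k₂ - k₁)| * (M - 2) ≤ 128 * M := by
      have x1 := mul_le_mul_of_nonneg_right d1 (by omega : 0 ≤ M - 2)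
      have x2 := mul_le_mul_of_nonneg_left c12 (by omega : 0 ≤ j₃ - j₂)
      have x3 := mul_le_mul_of_nonneg_left c23 (by omega : 0 ≤ j₂ - j₁)
      have x4 := mul_le_mul_of_nonneg_right hs (by omega : 0 ≤ M - 2 * z)
      have x5 := mul_le_mul_of_nonneg_right hs' (by omega : 0 ≤ 2 * z)
      linarith
    by_contra hge
    push Not at hge
    have := mul_le_mul_of_nonneg_right hge (by omega : 0 ≤ M - 2)
    nlinarith
  · -- a pair that is not mirrored has equal steps
    have key : ∀ {j k j' k' u : ℤ}, j < j' → (j' - j) * shiftBound (j + j' - 1) ≤ 20 →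
        (j' - j) + (j' - j) * shiftBound (j + j' - 1) ≤ 25 → (j' - j) * z - (k' - k) = 81 * u →
        k + k' - 1 ≠ 0 →
        (j' - j) * (2 * z + (j + j' - 1) * 81) = (k' - k) * ((k + k' - 1) * 81 + 2) →
        k' - k = j' - j := by
      intro j k j' k' u hj hs hs' hu hne h
      have b := diff_mul_le (by omega) hz hzM hj le_rfl h
      have b' := le_of_mul_sub_two_le (by omega) (by omega) b
      have b'' : |k' - k| ≤ (j' - j) * shiftBound (j + j' - 1) :=
        le_trans (le_mul_of_one_le_right (abs_nonneg _) (abs_pos.2 hne)) b'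
      have := abs_le.1 b''
      rcases hz' with rfl | rfl <;> omega
    by_cases z12 : k₁ + k₂ - 1 = 0
    · exact fin (h12.trans h23) (key (h12.trans h23) s13 s13' hu13 (by omega) p13) p13 e₁
    · exact fin h12 (key h12 s12 s12' hu12 z12 p12) p12 e₁

/-! ### Contradictions from a pair of classes -/

/-- If nine consecutive shifts of a class `z / M` have all their values represented with the last
two variables in `{0, 1}`, then three of them agree in these variables, so `z = 1`. -/
lemma eq_one_of_nine_values {M a b c z X : ℤ} (ha : 0 < a)
    (hM : 131 ≤ M ∨ (M = 81 ∧ (z = 1 ∨ z = 28))) (hz : 0 < z) (hzM : 2 * z < M)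
    (h : ∀ j : ℤ, -4 ≤ j → j ≤ 4 → ∃ k s : ℤ, (s = 0 ∨ s = b ∨ s = c ∨ s = b + c) ∧
      X + a * (2 * z * j + M * (j * (j - 1))) = a * gonal M k + 2 * s) :
    z = 1 ∧ ∃ s : ℤ, (s = 0 ∨ s = b ∨ s = c ∨ s = b + c) ∧ X = 2 * s := by
  choose! k s hs hk using h
  have hmaps : ∀ j ∈ Finset.Icc (-4 : ℤ) 4, s j ∈ ({0, b, c, b + c} : Finset ℤ) := by
    intro j hj
    have := Finset.mem_Icc.1 hj
    simpa using hs j this.1 this.2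
  have hcard : ({0, b, c, b + c} : Finset ℤ).card * 2 < (Finset.Icc (-4 : ℤ) 4).card := by
    have : ({0, b, c, b + c} : Finset ℤ).card ≤ 4 := Finset.card_le_four
    have h9 : (Finset.Icc (-4 : ℤ) 4).card = 9 := by simp
    omega
  obtain ⟨σ, -, hσ⟩ := Finset.exists_lt_card_fiber_of_mul_lt_card_of_maps_to hmaps hcard
  obtain ⟨x, hx, y, hy, w, hw, hxy, hxw, hyw⟩ := Finset.two_lt_card.1 hσ
  simp only [Finset.mem_filter, Finset.mem_Icc] at hx hy hw
  obtain ⟨κ, hκ⟩ : ∃ κ, κ = 2 * z * x + M * (x * (x - 1)) - gonal M (k x) := ⟨_, rfl⟩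
  have hX : ∀ t, -4 ≤ t ∧ t ≤ 4 → s t = σ →
      a * (2 * z * t + M * (t * (t - 1)) - gonal M (k t)) = 2 * σ - X := by
    intro t ht hst
    have := hk t ht.1 ht.2
    rw [hst] at this
    linear_combination this
  have hval : ∀ t, -4 ≤ t ∧ t ≤ 4 → s t = σ →
      2 * z * t + M * (t * (t - 1)) - gonal M (k t) = κ := by
    intro t ht hst
    rw [hκ]
    exact mul_left_cancel₀ ha.ne' ((hX t ht hst).trans (hX x hx.1 hx.2).symm)
  have main : z = 1 ∧ κ = 0 := by
    have T : ∀ u v t, (-4 ≤ u ∧ u ≤ 4) ∧ s u = σ → (-4 ≤ v ∧ v ≤ 4) ∧ s v = σ →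
        (-4 ≤ t ∧ t ≤ 4) ∧ s t = σ → u < v → v < t → z = 1 ∧ κ = 0 :=
      fun u v t hu hv ht h1 h2 => eq_one_of_three_coincidences hM hz hzM hu.1.1 h1 h2 ht.1.2
        (hval u hu.1 hu.2) (hval v hv.1 hv.2) (hval t ht.1 ht.2)
    rcases lt_or_gt_of_ne hxy with h1 | h1 <;> rcases lt_or_gt_of_ne hxw with h2 | h2 <;>
      rcases lt_or_gt_of_ne hyw with h3 | h3
    · exact T _ _ _ hx hy hw h1 h3
    · exact T _ _ _ hx hw hy h2 h3
    · omega
    · exact T _ _ _ hw hx hy h2 h1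
    · exact T _ _ _ hy hx hw h1 h2
    · omega
    · exact T _ _ _ hy hw hx h3 h2
    · exact T _ _ _ hw hy hx h3 h1
  refine ⟨main.1, σ, ?_, ?_⟩
  · rw [← hx.2]
    exact hs x hx.1.1 hx.1.2
  · have := hX x hx.1 hx.2
    rw [← hκ, main.2] at this
    linarith

/-- A pair of classes modulo `M` at which the binary part `a P + b P` takes integral values; `A` is
the value at `((z₁ + M - 1) / M, (z₂ + M - 1) / M)`. If `M ≡ 2 mod 4`, then the points have to be
`2`-integral, as in `RegularAtFractions`. -/
def AdmissibleClass (M a b z₁ z₂ A : ℤ) : Prop :=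
  (M % 4 = 2 → Odd z₁ ∧ Odd z₂) ∧
    2 * M * A = a * ((z₁ + M - 1) * (z₁ + 1)) + b * ((z₂ + M - 1) * (z₂ + 1))

lemma AdmissibleClass.exists_gonal {M a b c z₁ z₂ A : ℤ} (h : AdmissibleClass M a b z₁ z₂ A)
    (H : RegularAtFractions M a b c) {j J e n : ℤ} (hJ : j * (j - 1) = 2 * J)
    (he : e = 0 ∨ e = 1) (hn : n = A + a * ((j - 1) * z₁ + M * J) - e * (b * z₂)) (h0 : 0 ≤ n) :
    ∃ k₁ k₂ k₃ : ℤ, a * gonal M k₁ + b * gonal M k₂ + c * gonal M k₃ = 2 * n := by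
  obtain ⟨hodd, hA⟩ := h
  refine H (z₁ + j * M) (z₂ + (1 - e) * M) n h0 (fun h4 => ?_) ?_
  · obtain ⟨⟨x, hx⟩, ⟨y, hy⟩⟩ := hodd h4
    obtain ⟨M', hM'⟩ : ∃ M', M = 2 * M' := ⟨M / 2, by omega⟩
    exact ⟨⟨x + j * M', by rw [hx, hM']; ring⟩, ⟨y + (1 - e) * M', by rw [hy, hM']; ring⟩⟩
  · subst hn
    rcases he with rfl | rfl <;> linear_combination -hA + M * M * a * hJ

lemma AdmissibleClass.four_mul_le {M a b z₁ z₂ A : ℤ} (h : AdmissibleClass M a b z₁ z₂ A)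
    (hM : 3 ≤ M) (ha : 0 < a) (hb : 0 < b) (h1 : 0 < z₁) (h1' : 2 * z₁ ≤ M) (h2 : 0 < z₂)
    (h2' : 2 * z₂ ≤ M) : 4 * A ≤ 3 * (a * z₁) + 3 * (b * z₂) + 2 * a + 2 * b := by
  have e1 : ∀ z : ℤ, 0 < z → 2 * z ≤ M → 2 * ((z + M - 1) * (z + 1)) ≤ M * (3 * z + 2) := by
    intro z hz hzM
    nlinarith [mul_le_mul_of_nonneg_left hzM hz.le]
  have f1 := mul_le_mul_of_nonneg_left (e1 z₁ h1 h1') ha.le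
  have f2 := mul_le_mul_of_nonneg_left (e1 z₂ h2 h2') hb.le
  have f3 := h.2
  refine le_of_mul_le_mul_left (a := M) ?_ (by omega)
  linarith

lemma AdmissibleClass.le_two_mul {M a b z₁ z₂ A : ℤ} (h : AdmissibleClass M a b z₁ z₂ A)
    (hM : 3 ≤ M) (ha : 0 < a) (hb : 0 < b) (h1 : 0 < z₁) (h2 : 0 < z₂) :
    a * z₁ + b * z₂ + a + b ≤ 2 * A := by
  have e1 : ∀ z : ℤ, 0 < z → M * (z + 1) ≤ (z + M - 1) * (z + 1) := by
    intro z hz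
    nlinarith [mul_nonneg (by omega : 0 ≤ z - 1) (by omega : 0 ≤ z + 1)]
  have f1 := mul_le_mul_of_nonneg_left (e1 z₁ h1) ha.le
  have f2 := mul_le_mul_of_nonneg_left (e1 z₂ h2) hb.le
  have f3 := h.2
  refine le_of_mul_le_mul_left (a := M) ?_ (by omega)
  linarith

/-- An admissible pair of classes contradicts regularity if `b / a` is small. -/
lemma AdmissibleClass.false_of_five_mul_le {M a b c z₁ z₂ A : ℤ}
    (h : AdmissibleClass M a b z₁ z₂ A) (H : RegularAtFractions M a b c) (hM : 39 ≤ M)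
    (ha : 0 < a) (hab : a ≤ b) (hbc : b ≤ c) (hba : 5 * b ≤ 8 * a) (h1 : 0 < z₁)
    (h1' : 2 * z₁ ≤ M) (h1'' : 13 * M + 5 ≤ 5 * (z₁ * z₁)) (h2 : 3 ≤ z₂) (h2' : 2 * z₂ ≤ M)
    (hor : 93 ≤ M ∨ 5 * z₁ ≤ 2 * M) : False := by
  have hb : 0 < b := by omega
  have hup := h.four_mul_le (by omega) ha hb h1 h1' (by omega) h2'
  have hlow := h.le_two_mul (by omega) ha hb h1 (by omega)
  have hz1 : 11 ≤ z₁ := by nlinarith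
  have m1 : 11 * a ≤ a * z₁ := by nlinarith
  have m2 : 3 * b ≤ b * z₂ := by nlinarith
  have m3 : 10 * (b * z₂) ≤ 8 * (a * M) := by
    have := mul_le_mul_of_nonneg_right hba (by omega : 0 ≤ 2 * z₂)
    have := mul_le_mul_of_nonneg_left h2' (by omega : 0 ≤ 8 * a)
    linarith
  have hA1 : A < a * (M - 1) := by
    rcases hor with hor | hor
    · have := mul_le_mul_of_nonneg_left h1' ha.le
      have := mul_le_mul_of_nonneg_left hor ha.le
      linarith
    · have := mul_le_mul_of_nonneg_left hor ha.le
      have := mul_le_mul_of_nonneg_left hM ha.le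
      linarith
  have val : ∀ n, 0 ≤ n → n ≤ A → (∃ j J e, j * (j - 1) = 2 * J ∧ (e = 0 ∨ e = 1) ∧
      n = A + a * ((j - 1) * z₁ + M * J) - e * (b * z₂)) →
      n ≤ a + b ∨ (c ≤ n ∧ n ≤ a + b + c) := by
    rintro n h0 hnA ⟨j, J, e, hJ, he, hn⟩
    obtain ⟨k₁, k₂, k₃, hk⟩ := h.exists_gonal H hJ he hn h0
    have := near_zero_or_near_of_lt (by omega) ha hab hbc (by omega) hk
    omega
  have vA := val A (by linarith) le_rfl ⟨1, 0, 0, by simp, by simp, by ring⟩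
  have hB : A - a * z₁ ≤ a + b := by
    by_contra hn
    have := val (A - a * z₁) (by omega) (by omega) ⟨0, 0, 0, by simp, by simp, by ring⟩
    omega
  have hC : A - b * z₂ ≤ a + b := by
    by_contra hn
    have := val (A - b * z₂) (by omega) (by omega) ⟨1, 0, 1, by simp, by simp, by ring⟩
    omega
  -- the sum of the last two values is too large, because of the term `a z₁² / M`
  have hsum : M * (2 * A) ≤ M * (a * z₁ + b * z₂ + 2 * a + 2 * b) :=
    mul_le_mul_of_nonneg_left (by linarith) (by omega)
  have f3 := h.2
  have f4 := mul_le_mul_of_nonneg_left h1'' ha.le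
  have f5 : 3 * 3 ≤ z₂ * z₂ := mul_le_mul h2 h2 (by omega) (by omega)
  have f6 := mul_le_mul_of_nonneg_left f5 hb.le
  have f7 := mul_le_mul_of_nonneg_right hba (by omega : 0 ≤ M)
  linarith

/-- Three numbers cannot be represented with `k₁ ∈ {-1, 0, 1, 2}` and `k₂, k₃ ∈ {0, 1}` if no two
of them agree in the third variable. -/
lemma false_of_three_values {M a b c x y w : ℤ} (hM : 3 ≤ M) (ha : 0 < a) (hab : a ≤ b)
    (hbc : b ≤ c) (hba : b ≤ 5 * a) (hw1 : w < b * (M - 1)) (hw2 : w < a * (3 * M - 2))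
    (hxy : 8 * a < y - x) (hyw : 8 * a < w - y) (hxw : w - x < a * M - 8 * a)
    (rep : ∀ n, n = x ∨ n = y ∨ n = w → ∃ k₁ k₂ k₃ : ℤ,
      a * gonal M k₁ + b * gonal M k₂ + c * gonal M k₃ = 2 * n) : False := by
  have key : ∀ n, n = x ∨ n = y ∨ n = w → ∃ τ, (τ = 0 ∨ τ = c) ∧
      (0 ≤ n - τ ∧ n - τ ≤ a + b ∨ a * M - a ≤ n - τ ∧ n - τ ≤ a * M + 2 * a + b) := by
    intro n hn
    obtain ⟨k₁, k₂, k₃, hk⟩ := rep n hn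
    have hn1 : n ≤ w := by omega
    obtain ⟨k, s, hs, h2⟩ := exists_gonal_of_lt hM ha hab hbc (by omega) hk
    have hk' : k = -1 ∨ k = 0 ∨ k = 1 ∨ k = 2 := by
      by_contra hne
      have hg : 2 * (3 * M - 2) ≤ gonal M k := by
        unfold gonal
        rcases le_or_gt k (-2) with h | h
        · have h3 : 0 ≤ -2 - k := by omega
          nlinarith [mul_nonneg h3 h3, mul_nonneg (by omega : (0:ℤ) ≤ M - 3) (mul_nonneg h3 h3)]
        · have h3 : 0 ≤ k - 3 := by omega
          nlinarith [mul_nonneg h3 h3, mul_nonneg (by omega : (0:ℤ) ≤ M - 3) (mul_nonneg h3 h3)]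
      have := mul_le_mul_of_nonneg_left hg ha.le
      have : 0 ≤ s := by omega
      linarith
    have hval : n - s = 0 ∨ n - s = a ∨ n - s = a * M - a ∨ n - s = a * M + 2 * a := by
      rcases hk' with rfl | rfl | rfl | rfl
      · right; right; left; unfold gonal at h2; linarith
      · left; unfold gonal at h2; linarith
      · right; left; unfold gonal at h2; linarith
      · right; right; right; unfold gonal at h2; linarith
    clear rep hk h2 hn hw1 hw2 hxy hyw hxw
    generalize a * M = t at *
    rcases hs with hs | hs | hs | hs
    · exact ⟨0, Or.inl rfl, by omega⟩
    · exact ⟨0, Or.inl rfl, by omega⟩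
    · exact ⟨c, Or.inr rfl, by omega⟩
    · exact ⟨c, Or.inr rfl, by omega⟩
  have h1 := key x (by simp)
  have h2 := key y (by simp)
  have h3 := key w (by simp)
  clear rep key hw1 hw2
  generalize a * M = t at *
  obtain ⟨τ₁, ht1, h1⟩ := h1
  obtain ⟨τ₂, ht2, h2⟩ := h2
  obtain ⟨τ₃, ht3, h3⟩ := h3
  rcases ht1 with rfl | rfl <;> rcases ht2 with rfl | rfl <;> rcases ht3 with rfl | rfl <;> omega

/-- The range `8 / 5 ≤ b / a ≤ 5`. -/
lemma AdmissibleClass.false_of_le_five_mul {M a b c z₁ z₂ A : ℤ}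
    (h : AdmissibleClass M a b z₁ z₂ A) (H : RegularAtFractions M a b c) (hM : 39 ≤ M)
    (ha : 0 < a) (hbc : b ≤ c) (hba : 8 * a ≤ 5 * b) (hba' : b ≤ 5 * a) (h1 : 8 < z₁)
    (h1' : 8 < M - 2 * z₁) (h2 : 6 ≤ z₂) (h2' : 2 * z₂ ≤ M) : False := by
  have hb : 0 < b := by omega
  have hup := h.four_mul_le (by omega) ha hb (by omega) (by omega) (by omega) h2'
  have hlow := h.le_two_mul (by omega) ha hb (by omega) (by omega)
  have m1 : 9 * a ≤ a * z₁ := by nlinarith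
  have m2 : 6 * b ≤ b * z₂ := by nlinarith
  have m3 : 2 * (a * z₁) ≤ a * M - 9 * a := by nlinarith
  have m4 : 39 * a ≤ a * M := by nlinarith
  have m5 : 2 * (b * z₂) ≤ b * M := by nlinarith
  have m6 : b * M ≤ 5 * (a * M) := by nlinarith
  have m7 : 8 * (a * M) ≤ 5 * (b * M) := by nlinarith
  have hw1 : A + a * (M - 2 * z₁) < b * (M - 1) := by
    have := mul_le_mul_of_nonneg_right hba (by omega : 0 ≤ 4 * M - 5 * z₁)
    have : 45 * b ≤ 5 * b * z₁ := by nlinarith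
    linarith
  have hw2 : A + a * (M - 2 * z₁) < a * (3 * M - 2) := by linarith
  have hab : a ≤ b := by omega
  -- the values at `z₁`, `z₁ + M`, `z₁ - M`; if the first is negative, it is replaced by the value
  -- with `z₂` in place of `z₂ + M`
  rcases le_or_gt (a * z₁) A with hB | hB
  · refine false_of_three_values (x := A - a * z₁) (y := A) (w := A + a * (M - 2 * z₁))
      (by omega) ha hab hbc hba' hw1 hw2 (by linarith) (by linarith) (by linarith) ?_
    rintro n (rfl | rfl | rfl)
    · exact h.exists_gonal H (j := 0) (J := 0) (e := 0) (by simp) (by simp) (by ring) (by linarith)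
    · exact h.exists_gonal H (j := 1) (J := 0) (e := 0) (by simp) (by simp) (by ring) (by linarith)
    · exact h.exists_gonal H (j := -1) (J := 1) (e := 0) (by simp) (by simp) (by ring)
        (by linarith)
  · refine false_of_three_values (x := A - b * z₂) (y := A) (w := A + a * (M - 2 * z₁))
      (by omega) ha hab hbc hba' hw1 hw2 (by linarith) (by linarith) (by linarith) ?_
    rintro n (rfl | rfl | rfl)
    · exact h.exists_gonal H (j := 1) (J := 0) (e := 1) (by simp) (by simp) (by ring) (by linarith)
    · exact h.exists_gonal H (j := 1) (J := 0) (e := 0) (by simp) (by simp) (by ring) (by linarith)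
    · exact h.exists_gonal H (j := -1) (J := 1) (e := 0) (by simp) (by simp) (by ring)
        (by linarith)

lemma run_bounds {M z j J : ℤ} (hz : 0 ≤ z) (hzM : 2 * z ≤ M) (hJ : j * (j - 1) = 2 * J)
    (hj : -4 ≤ j) (hj' : j ≤ 4) : 0 ≤ z * j + M * J ∧ z * j + M * J ≤ 10 * M - 4 * z ∧
      (-2 ≤ j → j ≤ 2 → z * j + M * J ≤ 3 * M - 2 * z) := by
  have h : 2 * (M * J) = M * (j * (j - 1)) := by rw [hJ]; ring
  clear hJ
  generalize M * J = t at h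
  interval_cases j <;> omega

/-- A run of values at shifts of the first class, none of which reaches `b (M - 1)`. -/
lemma AdmissibleClass.exists_run {M a b c z₁ z₂ A : ℤ}
    (h : AdmissibleClass M a b z₁ z₂ A) (H : RegularAtFractions M a b c) (hM : 39 ≤ M)
    (ha : 0 < a) (hab : a ≤ b) (hbc : b ≤ c) (hba : 5 * a ≤ b) (h1 : 8 < z₁) (h1' : 2 * z₁ ≤ M)
    (h2 : 0 < z₂) (h2' : 2 * z₂ ≤ M) (h2'' : M ≤ 20 * z₂) {j : ℤ}
    (hj : -2 ≤ j ∧ j ≤ 2 ∨ -4 ≤ j ∧ j ≤ 4 ∧ 16 * a ≤ b) :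
    ∃ k s : ℤ, (s = 0 ∨ s = b ∨ s = c ∨ s = b + c) ∧
      2 * (A - a * z₁) + a * (2 * z₁ * j + M * (j * (j - 1))) = a * gonal M k + 2 * s := by
  have hb : 0 < b := by omega
  have hup := h.four_mul_le (by omega) ha hb (by omega) (by omega) (by omega) h2'
  obtain ⟨J, hJ⟩ : ∃ J, j * (j - 1) = 2 * J := by
    obtain ⟨x, hx⟩ := (Int.even_mul_succ_self (j - 1)).two_dvd
    exact ⟨x, by linear_combination hx⟩
  -- the value at `j = 0` is not negative, thanks to the contribution of `z₂`
  have hB : a * z₁ ≤ A := by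
    have f1 := mul_nonneg ha.le (mul_self_nonneg (M - 2 * z₁))
    have f2 : a * M ≤ 4 * (b * z₂) := by
      have := mul_le_mul_of_nonneg_left h2'' ha.le
      have := mul_le_mul_of_nonneg_right hba (by omega : 0 ≤ z₂)
      linarith
    have f3 := mul_le_mul_of_nonneg_right f2 (by omega : 0 ≤ M)
    have f4 := mul_nonneg hb.le (mul_self_nonneg z₂)
    have f5 := mul_nonneg ha.le (by omega : 0 ≤ M - 1)
    have f6 := mul_nonneg hb.le (by omega : 0 ≤ M - 1)
    have f7 := h.2
    refine le_of_mul_le_mul_left (a := M) ?_ (by omega)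
    linarith
  have m1 : 9 * a ≤ a * z₁ := by nlinarith
  have m2 : 2 * (a * z₁) ≤ a * M := by nlinarith
  have m3 : 2 * (b * z₂) ≤ b * M := by nlinarith
  have m4 : 39 * a ≤ a * M := by nlinarith
  have m5 : 39 * b ≤ b * M := by nlinarith
  have hbd := run_bounds (by omega : 0 ≤ z₁) h1' hJ (by omega) (by omega)
  have hlow : a * z₁ ≤ a * (z₁ * j + M * J) + a * z₁ := by
    have : 0 ≤ z₁ * j + M * J := hbd.1
    have := mul_nonneg ha.le this
    linarith
  have hhigh : A - a * z₁ + a * (z₁ * j + M * J) < b * (M - 1) := by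
    rcases hj with ⟨x, y⟩ | ⟨x, y, hba''⟩
    · have : z₁ * j + M * J ≤ 3 * M - 2 * z₁ := hbd.2.2 x y
      have := mul_le_mul_of_nonneg_left this ha.le
      have := mul_le_mul_of_nonneg_right hba (by omega : 0 ≤ M - 6)
      linarith
    · have : z₁ * j + M * J ≤ 10 * M - 4 * z₁ := hbd.2.1
      have := mul_le_mul_of_nonneg_left this ha.le
      have := mul_le_mul_of_nonneg_right hba'' (by omega : 0 ≤ 5 * M - 12)
      linarith
  obtain ⟨k₁, k₂, k₃, hk⟩ := h.exists_gonal H (n := A - a * z₁ + a * (z₁ * j + M * J)) hJ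
    (Or.inl rfl) (by ring) (by linarith)
  obtain ⟨k, s, hs, h3⟩ := exists_gonal_of_lt (by omega) ha hab hbc hhigh hk
  exact ⟨k, s, hs, by rw [← h3, hJ]; ring⟩

/-- The range `b / a ≥ 16`, where all nine values of `eq_one_of_nine_values` are small enough. -/
lemma AdmissibleClass.false_of_sixteen_mul_le {M a b c z₁ z₂ A : ℤ}
    (h : AdmissibleClass M a b z₁ z₂ A) (H : RegularAtFractions M a b c)
    (hM : 131 ≤ M ∨ (M = 81 ∧ z₁ = 28)) (ha : 0 < a) (hbc : b ≤ c)
    (hba : 16 * a ≤ b) (h1 : 8 < z₁) (h1' : 2 * z₁ < M)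
    (h2 : 0 < z₂) (h2' : 2 * z₂ ≤ M) (h2'' : M ≤ 20 * z₂) : False := by
  have := eq_one_of_nine_values ha (hM.imp_right fun h => ⟨h.1, Or.inr h.2⟩) (by omega) h1'
    fun j hj hj' => h.exists_run H (by omega) ha (by omega) hbc (by omega) h1 h1'.le h2 h2' h2''
      (j := j) (Or.inr ⟨hj, hj', hba⟩)
  omega

lemma shiftBound_pair_two : ∀ j ∈ Finset.Icc (-2 : ℤ) 2, ∀ j' ∈ Finset.Icc (-2 : ℤ) 2, j < j' →
    (j' - j) * shiftBound (j + j' - 1) ≤ 6 := by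
  unfold shiftBound
  decide

/-- The range `5 ≤ b / a ≤ 16`, where five values are available, two of which agree in the last two
variables. The steps between these are too short, except if `3 z₁` or `4 z₁` is close to `M`. -/
lemma AdmissibleClass.false_of_le_sixteen_mul {M a b c z₁ z₂ A : ℤ}
    (h : AdmissibleClass M a b z₁ z₂ A) (H : RegularAtFractions M a b c) (hM : 39 ≤ M)
    (ha : 0 < a) (hbc : b ≤ c)
    (hba : 5 * a ≤ b) (hba' : b ≤ 16 * a) (h1 : 8 < z₁) (h1' : 8 < M - 2 * z₁)
    (h3 : 3 * z₁ - M = 3 ∨ 6 < |3 * z₁ - M|) (h4 : 4 * z₁ - M = 4 ∨ 6 < |4 * z₁ - M|)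
    (h2 : 0 < z₂) (h2' : 2 * z₂ ≤ M) (h2'' : M ≤ 20 * z₂) : False := by
  have hrun : ∀ j : ℤ, -2 ≤ j → j ≤ 2 → ∃ k s : ℤ, (s = 0 ∨ s = b ∨ s = c ∨ s = b + c) ∧
      2 * (A - a * z₁) + a * (2 * z₁ * j + M * (j * (j - 1))) = a * gonal M k + 2 * s :=
    fun j hj hj' => h.exists_run H (by omega) ha (by omega) hbc (by omega) h1 (by omega) h2 h2' h2''
      (j := j) (Or.inl ⟨hj, hj'⟩)
  choose! k s hs hk using hrun
  have hmaps : ∀ j ∈ Finset.Icc (-2 : ℤ) 2, s j ∈ ({0, b, c, b + c} : Finset ℤ) := by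
    intro j hj
    have := Finset.mem_Icc.1 hj
    simpa using hs j this.1 this.2
  have hcard : ({0, b, c, b + c} : Finset ℤ).card < (Finset.Icc (-2 : ℤ) 2).card := by
    have : ({0, b, c, b + c} : Finset ℤ).card ≤ 4 := Finset.card_le_four
    have h9 : (Finset.Icc (-2 : ℤ) 2).card = 5 := by simp
    omega
  obtain ⟨x, hx, y, hy, hxy, hsxy⟩ := Finset.exists_ne_map_eq_of_card_lt_of_maps_to hcard hmaps
  wlog hlt : x < y generalizing x y
  · exact this y hy x hx hxy.symm hsxy.symm (by omega)
  have hx' := Finset.mem_Icc.1 hx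
  have hy' := Finset.mem_Icc.1 hy
  have ex := hk x hx'.1 hx'.2
  have ey := hk y hy'.1 hy'.2
  rw [hsxy] at ex
  obtain ⟨p, u, hu⟩ := pair_eq (M := M) (z := z₁) (j := x) (k := k x) (j' := y) (k' := k y)
    (mul_left_cancel₀ ha.ne' (by linear_combination ex - ey))
  have hne := diff_ne_zero (by omega) (by omega) (by omega) p
  by_cases hmir : k x + k y - 1 = 0
  · -- mirror images: the step is at most `7`, since the values are at most `9 a M`
    have hb : 0 < b := by omega
    have hs0 : 0 ≤ s y := by
      have := hs y hy'.1 hy'.2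
      omega
    have hup := h.four_mul_le (by omega) ha hb (by omega) (by omega) (by omega) h2'
    have m1 : 9 * a ≤ a * z₁ := by nlinarith
    have m3 : 2 * (b * z₂) ≤ b * M := by nlinarith
    have m4 : b * M ≤ 16 * (a * M) := by nlinarith
    have hpoly : ∀ j, -2 ≤ j ∧ j ≤ 2 → 2 * z₁ * j + M * (j * (j - 1)) ≤ 6 * M - 4 * z₁ := by
      rintro j ⟨hj, hj'⟩
      interval_cases j <;> omega
    have hg : ∀ j, -2 ≤ j ∧ j ≤ 2 → s j = s y → gonal M (k j) < 18 * M := by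
      intro j hj hsj
      have := mul_le_mul_of_nonneg_left (hpoly j hj) ha.le
      have e := hk j hj.1 hj.2
      rw [hsj] at e
      by_contra hge
      have := mul_le_mul_of_nonneg_left (not_lt.1 hge) ha.le
      linarith
    have hbd : ∀ t, gonal M t < 18 * M → t < 5 := by
      intro t ht
      by_contra hge
      unfold gonal at ht
      nlinarith [mul_nonneg (by omega : 0 ≤ t - 5) (by omega : 0 ≤ t - 5),
        mul_nonneg (by omega : (0 : ℤ) ≤ M)
          (mul_nonneg (by omega : 0 ≤ t - 5) (by omega : 0 ≤ t - 5))]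
    have b1 := hbd _ (hg x hx' hsxy)
    have b2 := hbd _ (hg y hy' rfl)
    rw [hmir, zero_mul, zero_add] at p
    have hkd : -7 ≤ k y - k x ∧ k y - k x ≤ 7 := by omega
    clear hk hs hmaps ex ey hu hg hbd hpoly h hsxy hx hy hup H
    generalize k y - k x = d at p hkd
    obtain ⟨x1, x2⟩ := hx'
    obtain ⟨y1, y2⟩ := hy'
    interval_cases x <;> interval_cases y <;> omega
  · have hX := shiftBound_pair_two x hx y hy hlt
    have b1 := diff_mul_le (by omega) (by omega) (by omega) hlt hX p
    have b2 := le_of_mul_sub_two_le (by omega) (by omega) b1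
    have b3 : |k y - k x| ≤ 6 :=
      le_trans (le_mul_of_one_le_right (abs_nonneg _) (abs_pos.2 hmir)) b2
    have b4 := abs_le.1 b3
    have hd : k y - k x = y - x := by
      have hyx : y - x = 1 ∨ y - x = 2 ∨ y - x = 3 ∨ y - x = 4 := by omega
      have hu1 : (y - x) * z₁ - (k y - k x) = M * u := hu
      rcases lt_trichotomy u 1 with hu0 | rfl | hu2
      · have : M * u ≤ 0 := mul_nonpos_of_nonneg_of_nonpos (by omega) (by omega)
        rcases hyx with e | e | e | e <;> rw [e] at hu1 <;> omega
      · rw [lt_abs] at h3 h4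
        rcases hyx with e | e | e | e <;> rw [e] at hu1 ⊢ <;> omega
      · have : M * 2 ≤ M * u := mul_le_mul_of_nonneg_left (by omega) (by omega)
        rcases hyx with e | e | e | e <;> rw [e] at hu1 <;> omega
    have := eq_one_of_diff_eq (by omega) (by omega) hlt hd p
    omega

/-- An admissible pair of classes contradicts regularity if `b / a` is not small. -/
lemma AdmissibleClass.false_of_eight_mul_le {M a b c z₁ z₂ A : ℤ}
    (h : AdmissibleClass M a b z₁ z₂ A) (H : RegularAtFractions M a b c)
    (hM : 131 ≤ M ∨ (M = 81 ∧ z₁ = 28)) (ha : 0 < a) (hbc : b ≤ c)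
    (hba : 8 * a ≤ 5 * b) (h1 : 8 < z₁) (h1' : 8 < M - 2 * z₁)
    (h3 : 3 * z₁ - M = 3 ∨ 6 < |3 * z₁ - M|) (h4 : 4 * z₁ - M = 4 ∨ 6 < |4 * z₁ - M|)
    (h2 : 6 ≤ z₂) (h2' : 2 * z₂ ≤ M) (h2'' : M ≤ 20 * z₂) : False := by
  rcases le_or_gt b (5 * a) with h5 | h5
  · exact h.false_of_le_five_mul H (by omega) ha hbc hba h5 h1 h1' h2 h2'
  rcases le_or_gt b (16 * a) with h6 | h6
  · exact h.false_of_le_sixteen_mul H (by omega) ha hbc h5.le h6 h1 h1' h3 h4 (by omega) h2' h2''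
  · exact h.false_of_sixteen_mul_le H hM ha hbc h6.le h1 (by omega) (by omega) h2' h2''

/-- Regularity fails if the second variable alone takes suitable integral multiples `N₁`, `N₂` of
`1 / b`. -/
lemma false_of_second_class {M a b c w₁ w₂ N₁ N₂ : ℤ} (hM : 131 ≤ M ∨ M = 81) (ha : 0 < a)
    (hab : a ≤ b) (hbc : b ≤ c) (H : RegularAtFractions M a b c)
    (hw₁ : M % 4 = 2 → Odd w₁) (hw₂ : M % 4 = 2 → Odd w₂)
    (e₁ : b * ((w₁ - 1) * (w₁ - M + 1)) = 2 * M * N₁)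
    (e₂ : b * ((w₂ - 1) * (w₂ - M + 1)) = 2 * M * N₂)
    (hN₁ : 2 * b < N₁) (hN : N₁ + b < N₂)
    (hN₂ : N₂ * (11 * M - 2) < b * ((M - 1) * (M - 2))) : False := by
  have val : ∀ w N, (M % 4 = 2 → Odd w) → b * ((w - 1) * (w - M + 1)) = 2 * M * N → 0 ≤ N →
      ∀ j J, j * (j - 1) = 2 * J → 0 ≤ M * J + j → ∃ k₁ k₂ k₃ : ℤ,
        a * gonal M k₁ + b * gonal M k₂ + c * gonal M k₃ = 2 * (N + a * (M * J + j)) := by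
    intro w N hw he hN j J hJ h0
    refine H (1 + j * M) w _ (add_nonneg hN (mul_nonneg ha.le h0)) (fun h4 => ⟨?_, hw h4⟩) ?_
    · obtain ⟨M', hM'⟩ : ∃ M', M = 2 * M' := ⟨M / 2, by omega⟩
      exact ⟨j * M', by rw [hM']; ring⟩
    · linear_combination he + M * M * a * hJ
  have hfin : ∀ N, 2 * b < N → N = 0 ∨ N = b ∨ N = c ∨ N = b + c → N = c ∨ N = b + c := by
    intro N _ _
    omega
  rcases lt_or_ge (N₂ + a) (a * (M - 1)) with hlt | hge
  · obtain ⟨_, _, _, h1⟩ := val w₁ N₁ hw₁ e₁ (by omega) 0 0 (by simp) (by simp)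
    obtain ⟨_, _, _, h2⟩ := val w₂ N₂ hw₂ e₂ (by omega) 1 0 (by simp) (by simp)
    have := near_zero_or_near_of_lt (by omega) ha hab hbc (by simp; omega) h1
    have := near_zero_or_near_of_lt (by omega) ha hab hbc (by simp; omega) h2
    simp at *
    omega
  · -- now `a` is so small that nine shifts of the first variable stay below `b (M - 1)`
    have run : ∀ w N, (M % 4 = 2 → Odd w) → b * ((w - 1) * (w - M + 1)) = 2 * M * N → 2 * b < N →
        N ≤ N₂ → N = c ∨ N = b + c := by
      intro w N hw he hN hN'
      have := eq_one_of_nine_values (M := M) (a := a) (b := b) (c := c) (z := 1) (X := 2 * N) ha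
        (hM.imp_right fun h => ⟨h, Or.inl rfl⟩) (by omega) (by omega) ?_
      · obtain ⟨-, s, hs, hX⟩ := this
        obtain rfl : N = s := by omega
        exact hfin N hN hs
      · intro j hj hj'
        obtain ⟨J, hJ⟩ : ∃ J, j * (j - 1) = 2 * J := by
          obtain ⟨x, hx⟩ := (Int.even_mul_succ_self (j - 1)).two_dvd
          exact ⟨x, by linear_combination hx⟩
        have hb1 : 0 ≤ M * J + j ∧ M * J + j ≤ 10 * M - 4 := by
          have := run_bounds (M := M) (z := 1) (by omega) (by omega) hJ hj hj'
          omega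
        obtain ⟨k₁, k₂, k₃, hk⟩ := val w N hw he (by omega) j J hJ hb1.1
        have hlt : N + a * (M * J + j) < b * (M - 1) := by
          refine lt_of_mul_lt_mul_right (a := M - 2) ?_ (by omega)
          have f1 := mul_le_mul_of_nonneg_left hb1.2 ha.le
          have f2 := mul_le_mul_of_nonneg_right f1 (by omega : 0 ≤ M - 2)
          have f3 := mul_le_mul_of_nonneg_right hge (by omega : 0 ≤ 10 * M - 4)
          have f4 := mul_le_mul_of_nonneg_right hN' (by omega : 0 ≤ M - 2)
          linarith
        obtain ⟨k, s, hs, h3⟩ := exists_gonal_of_lt (by omega) ha hab hbc hlt hk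
        exact ⟨k, s, hs, by rw [← h3, hJ]; ring⟩
    have := run w₁ N₁ hw₁ e₁ hN₁ (by omega)
    have := run w₂ N₂ hw₂ e₂ (by omega) le_rfl
    omega

/-! ### Admissible classes near `(1, 1)` -/

/-- The class of `(z₁, z₂)` is admissible up to signs as soon as `a (z₁² - 1) + b (z₂² - 1)` has
the right divisor. -/
lemma exists_admissibleClass_abs {M a b z₁ z₂ : ℤ}
    (h : M % 2 = 1 ∧ M ∣ a * (z₁ * z₁ - 1) + b * (z₂ * z₂ - 1) ∨
      Odd z₁ ∧ Odd z₂ ∧ 2 * M ∣ a * (z₁ * z₁ - 1) + b * (z₂ * z₂ - 1)) :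
    ∃ A, AdmissibleClass M a b |z₁| |z₂| A := by
  rw [← abs_mul_abs_self z₁, ← abs_mul_abs_self z₂, ← odd_abs (a := z₁),
    ← odd_abs (a := z₂)] at h
  generalize |z₁| = x at *
  generalize |z₂| = y at *
  rcases h with ⟨hM, h⟩ | ⟨⟨u, hu⟩, ⟨v, hv⟩, ⟨q, hq⟩⟩
  · have h2 : (2 : ℤ) ∣ a * ((x + M - 1) * (x + 1)) + b * ((y + M - 1) * (y + 1)) := by
      have ev : ∀ z : ℤ, Even ((z + M - 1) * (z + 1)) := by
        intro z
        rw [Int.even_mul, Int.even_iff, Int.even_iff]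
        omega
      exact (((ev x).mul_left a).add ((ev y).mul_left b)).two_dvd
    have hM' : M ∣ a * ((x + M - 1) * (x + 1)) + b * ((y + M - 1) * (y + 1)) := by
      obtain ⟨q, hq⟩ := h
      exact ⟨q + a * (x + 1) + b * (y + 1), by linear_combination hq⟩
    have hcop : IsCoprime (2 : ℤ) M := ⟨-(M / 2), 1, by omega⟩
    obtain ⟨q, hq⟩ := hcop.mul_dvd h2 hM'
    exact ⟨q, fun h4 => by omega, hq.symm⟩
  · refine ⟨q + a * (u + 1) + b * (v + 1), fun _ => ⟨⟨u, hu⟩, ⟨v, hv⟩⟩, ?_⟩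
    linear_combination -hq - M * a * hu - M * b * hv

/-- Odd classes gain the missing factor `4`, since odd squares are `1` modulo `8`. -/
lemma two_mul_dvd_of_odd {M a b z₁ z₂ : ℤ} (hM : M % 4 = 2) (h₁ : Odd z₁) (h₂ : Odd z₂)
    (h : M / 2 ∣ a * (z₁ * z₁ - 1) + b * (z₂ * z₂ - 1)) :
    2 * M ∣ a * (z₁ * z₁ - 1) + b * (z₂ * z₂ - 1) := by
  have h4 : (4 : ℤ) ∣ a * (z₁ * z₁ - 1) + b * (z₂ * z₂ - 1) := by
    obtain ⟨u, rfl⟩ := h₁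
    obtain ⟨v, rfl⟩ := h₂
    exact ⟨a * (u * u + u) + b * (v * v + v), by ring⟩
  have hcop : IsCoprime (4 : ℤ) (M / 2) := by
    have h2 : IsCoprime (2 : ℤ) (M / 2) := ⟨-(M / 2 / 2), 1, by omega⟩
    have := h2.pow_left (m := 2)
    norm_num at this
    exact this
  have := hcop.mul_dvd h4 h
  rwa [show 4 * (M / 2) = 2 * M by omega] at this

/-- The two ranges of `b / a` together. -/
lemma false_of_classes {M a b c z₁ z₂ : ℤ} (H : RegularAtFractions M a b c)
    (ha : 0 < a) (hab : a ≤ b) (hbc : b ≤ c) (hM : 131 ≤ M ∨ (M = 81 ∧ |z₁| = 28))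
    (h : M % 2 = 1 ∧ M ∣ a * (z₁ * z₁ - 1) + b * (z₂ * z₂ - 1) ∨
      Odd z₁ ∧ Odd z₂ ∧ 2 * M ∣ a * (z₁ * z₁ - 1) + b * (z₂ * z₂ - 1))
    (h1 : 13 * M + 5 ≤ 5 * (|z₁| * |z₁|)) (h1' : 8 < M - 2 * |z₁|)
    (h3 : 3 * |z₁| - M = 3 ∨ 6 < |3 * |z₁| - M|) (h4 : 4 * |z₁| - M = 4 ∨ 6 < |4 * |z₁| - M|)
    (h2 : 6 ≤ |z₂|) (h2' : 2 * |z₂| ≤ M) (h2'' : M ≤ 20 * |z₂|) : False := by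
  obtain ⟨A, hA⟩ := exists_admissibleClass_abs h
  have h8 : 8 < |z₁| := by
    by_contra hlt
    have : |z₁| * |z₁| ≤ 8 * 8 :=
      mul_le_mul (not_lt.1 hlt) (not_lt.1 hlt) (abs_nonneg _) (by norm_num)
    omega
  rcases le_total (5 * b) (8 * a) with hba | hba
  · exact hA.false_of_five_mul_le H (by omega) ha hab hbc hba (by omega) (by omega) h1 (by omega)
      h2' (by omega)
  · exact hA.false_of_eight_mul_le H hM ha hbc hba h8 h1' h3 h4 h2 h2' h2''

/-- Admissible classes near `(1, 1)`: here `M = d f Q`, the first class is `1` modulo `M / d`, and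
the second one is `1` modulo `Q`. -/
lemma mul_dvd_of_lift {M a b d f Q δ w v : ℤ} (hM : M = d * (f * Q)) (hδ : δ ∣ 2)
    (hQ : δ * d ∣ Q) (h : d ∣ a * w + b * v) :
    δ * M ∣ a * ((1 + w * (f * Q)) * (1 + w * (f * Q)) - 1) +
      f * b * ((1 + Q * v) * (1 + Q * v) - 1) := by
  obtain ⟨x, hx⟩ := hδ
  obtain ⟨y, hy⟩ := hQ
  obtain ⟨t, ht⟩ := h
  refine ⟨x * t + a * w * w * f * y + b * v * v * y, ?_⟩
  rw [hM]
  linear_combination 2 * f * Q * ht + (f * Q * d * t) * hx +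
    (f * Q * (a * w * w * f) + f * Q * b * v * v) * hy

/-- The contradiction from admissible classes near `(1, 1)`. -/
lemma false_of_lift {M a b c d f Q w v : ℤ} (H : RegularAtFractions M a (f * b) c)
    (ha : 0 < a) (hab : a ≤ f * b) (hbc : f * b ≤ c)
    (hM : 131 ≤ M ∨ (M = 81 ∧ |1 + w * (f * Q)| = 28)) (hMd : M = d * (f * Q)) (hd : d ∣ Q)
    (hd2 : M % 2 = 0 → 2 * d ∣ Q) (h : d ∣ a * w + b * v)
    (h1 : 13 * M + 5 ≤ 5 * (|1 + w * (f * Q)| * |1 + w * (f * Q)|))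
    (h1' : 8 < M - 2 * |1 + w * (f * Q)|)
    (h3 : 3 * |1 + w * (f * Q)| - M = 3 ∨ 6 < |3 * |1 + w * (f * Q)| - M|)
    (h4 : 4 * |1 + w * (f * Q)| - M = 4 ∨ 6 < |4 * |1 + w * (f * Q)| - M|)
    (h2 : 6 ≤ |1 + Q * v|) (h2' : 2 * |1 + Q * v| ≤ M) (h2'' : M ≤ 20 * |1 + Q * v|) : False := by
  refine false_of_classes H ha hab hbc hM ?_ h1 h1' h3 h4 h2 h2' h2''
  rcases Int.emod_two_eq_zero_or_one M with h0 | h0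
  · right
    obtain ⟨y, hy⟩ := hd2 h0
    exact ⟨⟨w * (f * (d * y)), by rw [hy]; ring⟩, ⟨d * y * v, by rw [hy]; ring⟩,
      mul_dvd_of_lift hMd dvd_rfl (hd2 h0) h⟩
  · left
    have := mul_dvd_of_lift (δ := 1) hMd (one_dvd _) (by simpa using hd) h
    exact ⟨h0, by simpa using this⟩

/-- If `f ≥ 3`, then the second class can be chosen in the upper part of the interval. -/
lemma false_of_lift_of_three_le {M a b c d f Q w : ℤ} (H : RegularAtFractions M a (f * b) c)
    (ha : 0 < a) (hab : a ≤ f * b) (hbc : f * b ≤ c)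
    (hM : 131 ≤ M ∨ (M = 81 ∧ |1 + w * (f * Q)| = 28)) (hMd : M = d * (f * Q)) (hd : d ∣ Q)
    (hd2 : M % 2 = 0 → 2 * d ∣ Q) (hd0 : 0 < d) (hQ0 : 0 < Q) (hf : 3 ≤ f) (hcop : IsCoprime b d)
    (h1 : 13 * M + 5 ≤ 5 * (|1 + w * (f * Q)| * |1 + w * (f * Q)|))
    (h1' : 8 < M - 2 * |1 + w * (f * Q)|)
    (h3 : 3 * |1 + w * (f * Q)| - M = 3 ∨ 6 < |3 * |1 + w * (f * Q)| - M|)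
    (h4 : 4 * |1 + w * (f * Q)| - M = 4 ∨ 6 < |4 * |1 + w * (f * Q)| - M|) : False := by
  obtain ⟨x, y, hxy⟩ := hcop
  have hdQ : 0 < d * Q := mul_pos hd0 hQ0
  obtain ⟨k, hk⟩ : ∃ k, k = (M / 2 - 1 + Q * (a * w * x)) / (d * Q) := ⟨_, rfl⟩
  have e1 := Int.mul_ediv_add_emod (M / 2 - 1 + Q * (a * w * x)) (d * Q)
  have e2 := Int.emod_nonneg (M / 2 - 1 + Q * (a * w * x)) hdQ.ne'
  have e3 := Int.emod_lt_of_pos (M / 2 - 1 + Q * (a * w * x)) hdQ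
  rw [← hk] at e1
  have e4 : Q * (d * k - a * w * x) = d * Q * k - Q * (a * w * x) := by ring
  have e5 : 3 * (d * Q) ≤ M := by
    rw [hMd]
    nlinarith
  have hpos : 0 < 1 + Q * (d * k - a * w * x) := by omega
  refine false_of_lift (v := d * k - a * w * x) H ha hab hbc hM hMd hd hd2
    ⟨a * w * y + b * k, by linear_combination -(a * w) * hxy⟩ h1 h1' h3 h4 ?_ ?_ ?_ <;>
    rw [abs_of_pos hpos] <;> omega

/-- If `d ∈ {3, 4}`, then the units modulo `d` are `±1`, and the second class is `±1 + Q`. -/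
lemma false_of_lift_of_le_two {M a b c d f Q : ℤ} (H : RegularAtFractions M a (f * b) c)
    (ha : 0 < a) (hab : a ≤ f * b) (hbc : f * b ≤ c)
    (hM : 131 ≤ M ∨ (M = 81 ∧ |1 + 1 * (f * Q)| = 28)) (hMd : M = d * (f * Q)) (hd : d ∣ Q)
    (hd2 : M % 2 = 0 → 2 * d ∣ Q) (hd34 : d = 3 ∨ d = 4) (hf : f = 1 ∨ f = 2)
    (had : IsCoprime a d) (hbd : IsCoprime b d)
    (h1 : 13 * M + 5 ≤ 5 * (|1 + 1 * (f * Q)| * |1 + 1 * (f * Q)|))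
    (h1' : 8 < M - 2 * |1 + 1 * (f * Q)|)
    (h3 : 3 * |1 + 1 * (f * Q)| - M = 3 ∨ 6 < |3 * |1 + 1 * (f * Q)| - M|)
    (h4 : 4 * |1 + 1 * (f * Q)| - M = 4 ∨ 6 < |4 * |1 + 1 * (f * Q)| - M|) : False := by
  have hunit : d ∣ a * 1 + b * 1 ∨ d ∣ a * 1 + b * (-1) := by
    have key : ∀ x : ℤ, IsCoprime x d → d = 3 ∧ x % 3 ≠ 0 ∨ d = 4 ∧ x % 2 = 1 := by
      rintro x hx
      have h := Int.isCoprime_iff_gcd_eq_one.1 hx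
      rcases hd34 with rfl | rfl
      · left
        refine ⟨rfl, fun h0 => ?_⟩
        have := Int.dvd_gcd (Int.dvd_of_emod_eq_zero h0) (dvd_refl 3)
        rw [h] at this
        norm_num at this
      · right
        refine ⟨rfl, ?_⟩
        by_contra h0
        have := Int.dvd_gcd (Int.dvd_of_emod_eq_zero (by omega : x % 2 = 0))
          (by norm_num : (2 : ℤ) ∣ 4)
        rw [h] at this
        norm_num at this
    have ka := key a had
    have kb := key b hbd
    rcases hd34 with rfl | rfl
    · have a3 : a % 3 = 1 ∨ a % 3 = 2 := by omega
      have b3 : b % 3 = 1 ∨ b % 3 = 2 := by omega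
      rcases a3 with a3 | a3 <;> rcases b3 with b3 | b3 <;> omega
    · omega
  have hQM : M = d * Q ∨ M = 2 * (d * Q) := by
    rcases hf with rfl | rfl
    · left; rw [hMd]; ring
    · right; rw [hMd]; ring
  have hQ : 9 ≤ Q ∧ 2 * Q + 2 ≤ M ∧ M ≤ 10 * Q := by
    rcases hd34 with rfl | rfl <;> omega
  rcases hunit with hu | hu
  · refine false_of_lift (v := 1) H ha hab hbc hM hMd hd hd2 hu h1 h1' h3 h4 ?_ ?_ ?_ <;>
      rw [abs_of_pos (by omega)] <;> omega
  · refine false_of_lift (v := -1) H ha hab hbc hM hMd hd hd2 hu h1 h1' h3 h4 ?_ ?_ ?_ <;>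
      rw [abs_of_neg (by omega)] <;> omega

/-- Distinct multiples of `u` stay apart after a small perturbation. -/
lemma dist_ge_of_ne {p u x y ε : ℤ} (hu : 0 < u) (hne : x ≠ p)
    (hy : y = x * u + ε - p * u) (hε : |ε| + 6 < u) : 6 < |y| := by
  have h1 : u ≤ |(x - p) * u| := by
    rw [abs_mul, abs_of_pos hu]
    exact le_mul_of_one_le_left hu.le (Int.one_le_abs (sub_ne_zero.2 hne))
  have h2 := abs_sub_abs_le_abs_sub ((x - p) * u) (-ε)
  rw [abs_neg] at h2
  rw [hy, show x * u + ε - p * u = (x - p) * u - -ε by ring]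
  omega

/-- The case `p ∤ a b` of `M = p Q` with `p ≥ 5` and `p ∣ Q`. -/
lemma false_of_lift_one {M a b c p Q : ℤ} (H : RegularAtFractions M a b c)
    (ha : 0 < a) (hab : a ≤ b) (hbc : b ≤ c) (hM : 131 ≤ M) (hMd : M = p * Q) (hp : Prime p)
    (hp5 : 5 ≤ p) (hpo : p % 2 = 1) (hd : p ∣ Q) (hd2 : M % 2 = 0 → 2 * p ∣ Q) (hQ : 13 ≤ Q)
    (hpa : ¬ p ∣ a) (hpb : ¬ p ∣ b) : False := by
  have hpQ : p ≤ Q := Int.le_of_dvd (by omega) hd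
  obtain ⟨x, y, hxy⟩ := (hp.coprime_iff_not_dvd.2 hpa)
  -- a second class `v` for which the corresponding first class `w` is not `0` or `±1`
  obtain ⟨v, w, hv, hwv, hw2, hwp⟩ : ∃ v w, (2 * v = p - 1 ∨ 2 * v = p - 3) ∧ p ∣ a * w + b * v ∧
      (2 ≤ w ∨ w ≤ -2) ∧ 2 * |w| < p := by
    have cand : ∀ v : ℤ, ∃ w, p ∣ a * w + b * v ∧ 2 * |w| < p := by
      intro v
      obtain ⟨r, hr⟩ : ∃ r, r = (-(y * b * v)) % p := ⟨_, rfl⟩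
      have h1 := Int.emod_nonneg (-(y * b * v)) (by omega : p ≠ 0)
      have h2 := Int.emod_lt_of_pos (-(y * b * v)) (by omega : 0 < p)
      have h3 := Int.mul_ediv_add_emod (-(y * b * v)) p
      rw [← hr] at h1 h2 h3
      have h4 : ∀ k, p ∣ a * (r + p * k) + b * v := by
        intro k
        refine ⟨b * v * x + a * k - a * ((-(y * b * v)) / p), ?_⟩
        linear_combination a * h3 - b * v * hxy
      rcases lt_or_ge (2 * r) p with h | h
      · exact ⟨r, by simpa using h4 0, by rw [abs_of_nonneg h1]; exact h⟩
      · exact ⟨r - p, by simpa [sub_eq_add_neg] using h4 (-1),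
          by rw [abs_of_neg (by omega)]; omega⟩
    obtain ⟨v₁, hv₁⟩ : ∃ v, 2 * v = p - 1 := ⟨(p - 1) / 2, by omega⟩
    obtain ⟨w₁, h₁, b₁⟩ := cand v₁
    obtain ⟨w₂, h₂, b₂⟩ := cand (v₁ - 1)
    by_contra hno
    push Not at hno
    have n₁ : ¬ (2 ≤ w₁ ∨ w₁ ≤ -2) := fun h => by
      have := hno v₁ w₁ (Or.inl hv₁) h₁ h
      omega
    have n₂ : ¬ (2 ≤ w₂ ∨ w₂ ≤ -2) := fun h => by
      have := hno (v₁ - 1) w₂ (Or.inr (by omega)) h₂ h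
      omega
    have nb : ∀ t : ℤ, p ∣ b * t → ¬ (0 < |t| ∧ |t| < p) := by
      rintro t ht ⟨h5, h6⟩
      have := Int.le_of_dvd h5 ((dvd_abs _ _).2 ((hp.dvd_or_dvd ht).resolve_left hpb))
      omega
    have z₁ : w₁ ≠ 0 := by
      rintro rfl
      refine nb v₁ (by simpa using h₁) ?_
      rw [abs_of_pos (by omega)]; omega
    have z₂ : w₂ ≠ 0 := by
      rintro rfl
      refine nb (v₁ - 1) (by simpa using h₂) ?_
      rw [abs_of_pos (by omega)]; omega
    have hww : w₁ = w₂ ∨ w₁ = -w₂ := by omega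
    rcases hww with rfl | rfl
    · have := dvd_sub h₁ h₂
      rw [show a * w₁ + b * v₁ - (a * w₁ + b * (v₁ - 1)) = b * 1 by ring] at this
      exact nb 1 this (by simp; omega)
    · have := dvd_add h₁ h₂
      rw [show a * -w₂ + b * v₁ + (a * w₂ + b * (v₁ - 1)) = b * (2 * v₁ - 1) by ring] at this
      refine nb (2 * v₁ - 1) this ?_
      rw [abs_of_pos (by omega)]; omega
  obtain ⟨s, ε, hs, hz, hε⟩ : ∃ s ε, s = |w| ∧ |1 + w * (1 * Q)| = s * Q + ε ∧
      (ε = 1 ∨ ε = -1) := by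
    rcases hw2 with h | h
    · exact ⟨w, 1, by rw [abs_of_pos (by omega)], by rw [abs_of_pos (by nlinarith)]; ring,
        by simp⟩
    · exact ⟨-w, -1, by rw [abs_of_neg (by omega)], by rw [abs_of_neg (by nlinarith)]; ring,
        by simp⟩
  have hs2 : 2 ≤ s := by
    rw [hs]
    rcases hw2 with h | h
    · exact h.trans (le_abs_self _)
    · have := neg_le_abs w
      omega
  have hsp : 2 * s + 1 ≤ p := by omega
  have hz1 : 0 < 1 + Q * v := by
    have : 0 ≤ Q * v := mul_nonneg (by omega) (by omega)
    omega
  have hsQ : 2 * Q ≤ s * Q := mul_le_mul_of_nonneg_right hs2 (by omega)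
  have hpS : (2 * s + 1) * Q ≤ p * Q := mul_le_mul_of_nonneg_right hsp (by omega)
  have hnd : ∀ k : ℤ, 1 < k → k < p → k * s ≠ p := by
    intro k hk hk' hks
    rcases hp.irreducible.isUnit_or_isUnit hks.symm with h | h
    · rcases Int.isUnit_iff.1 h with h | h <;> omega
    · rcases Int.isUnit_iff.1 h with h | h <;> omega
  have hvQ : 2 * (Q * v) = Q * (p - 1) ∨ 2 * (Q * v) = Q * (p - 3) := by
    rcases hv with h | h
    · left; rw [← h]; ring
    · right; rw [← h]; ring
  have hQp : Q * p = M := by rw [hMd]; ring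
  have hQp5 : Q * 5 ≤ Q * p := mul_le_mul_of_nonneg_left hp5 (by omega)
  refine false_of_lift (d := p) (f := 1) (Q := Q) (b := b) (w := w) (v := v) (by simpa using H)
    ha (by simpa using hab) (by simpa using hbc) (Or.inl hM) (by simpa using hMd) hd hd2 hwv
    ?_ ?_ ?_ ?_ ?_ ?_ ?_
  · rw [hz, hMd]
    have h1 : 2 * Q - 1 ≤ s * Q + ε := by omega
    have h2 : (2 * Q - 1) * (2 * Q - 1) ≤ (s * Q + ε) * (s * Q + ε) :=
      mul_le_mul h1 h1 (by omega) (by omega)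
    have h3 : p * Q ≤ Q * Q := mul_le_mul_of_nonneg_right hpQ (by omega)
    nlinarith
  · rw [hz]
    linarith [show ε ≤ 1 by omega]
  · right
    rw [hz]
    exact dist_ge_of_ne (p := p) (u := Q) (x := 3 * s) (ε := 3 * ε) (by omega)
      (hnd 3 (by omega) (by omega)) (by rw [hMd]; ring)
      (by rcases hε with rfl | rfl <;> norm_num <;> omega)
  · right
    rw [hz]
    refine dist_ge_of_ne (p := p) (u := Q) (x := 4 * s) (ε := 4 * ε) (by omega)
      (hnd 4 (by omega) (by omega)) (by rw [hMd]; ring)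
      (by rcases hε with rfl | rfl <;> norm_num <;> omega)
  · rw [abs_of_pos hz1]; rcases hvQ with h | h <;> linarith
  · rw [abs_of_pos hz1]; rcases hvQ with h | h <;> linarith
  · rw [abs_of_pos hz1]; rcases hvQ with h | h <;> linarith

/-! ### Admissible classes from a conic modulo a prime -/

lemma card_quadratic_roots_le {F : Type*} [Field F] [Fintype F] [DecidableEq F] {A B C : F}
    (h : A ≠ 0 ∨ B ≠ 0 ∨ C ≠ 0) :
    (Finset.univ.filter fun x : F => A * x ^ 2 + B * x + C = 0).card ≤ 2 := by
  let q : Polynomial F := Polynomial.C A * Polynomial.X ^ 2 + Polynomial.C B * Polynomial.X +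
    Polynomial.C C
  have hq : q ≠ 0 := by
    intro h0
    have c0 := congrArg (fun r : Polynomial F => r.coeff 0) h0
    have c1 := congrArg (fun r : Polynomial F => r.coeff 1) h0
    have c2 := congrArg (fun r : Polynomial F => r.coeff 2) h0
    simp [q, Polynomial.coeff_X, Polynomial.coeff_C] at c0 c1 c2
    tauto
  calc _ ≤ q.roots.toFinset.card := by
        refine Finset.card_le_card fun x hx => ?_
        rw [Multiset.mem_toFinset, Polynomial.mem_roots hq]
        simpa [q, Polynomial.IsRoot] using hx
    _ ≤ Multiset.card q.roots := Multiset.toFinset_card_le _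
    _ ≤ q.natDegree := q.card_roots'
    _ ≤ 2 := Polynomial.natDegree_quadratic_le

/-- The conic `a x² + b y² = a + b`, parametrised by the lines through `(1, 1)` with direction
`(α, 1)`, has a point whose coordinates avoid two small sets: each forbidden value excludes at most
two `α`. -/
lemma exists_conic_point_avoiding {F : Type*} [Field F] [Fintype F] [DecidableEq F] {a b : F}
    (ha : a ≠ 0) (hb : b ≠ 0) (h2 : (2 : F) ≠ 0) (S T : Finset F)
    (hcard : 2 * S.card + 2 * T.card + 2 < Fintype.card F) :
    ∃ x y : F, a * x ^ 2 + b * y ^ 2 = a + b ∧ x ∉ S ∧ y ∉ T := by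
  let R (A B C : F) : Finset F := Finset.univ.filter fun x : F => A * x ^ 2 + B * x + C = 0
  let bad : Finset F := R a 0 b ∪
    (S.biUnion fun ζ => R ((ζ + 1) * a) (2 * b) ((ζ - 1) * b)) ∪
    T.biUnion fun η => R ((η - 1) * a) (2 * a) ((η + 1) * b)
  have hbad : bad.card < Fintype.card F := by
    have e1 : (R a 0 b).card ≤ 2 := card_quadratic_roots_le (Or.inl ha)
    have e2 : (S.biUnion fun ζ => R ((ζ + 1) * a) (2 * b) ((ζ - 1) * b)).card ≤ S.card * 2 :=
      Finset.card_biUnion_le_card_mul _ _ _ fun _ _ =>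
        card_quadratic_roots_le (Or.inr (Or.inl (mul_ne_zero h2 hb)))
    have e3 : (T.biUnion fun η => R ((η - 1) * a) (2 * a) ((η + 1) * b)).card ≤ T.card * 2 :=
      Finset.card_biUnion_le_card_mul _ _ _ fun _ _ =>
        card_quadratic_roots_le (Or.inr (Or.inl (mul_ne_zero h2 ha)))
    have e4 : bad.card ≤ _ := Finset.card_union_le _ _
    have e5 := Finset.card_union_le (R a 0 b)
      (S.biUnion fun ζ => R ((ζ + 1) * a) (2 * b) ((ζ - 1) * b))
    omega
  obtain ⟨α, hα⟩ : ∃ α, α ∉ bad := by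
    by_contra hall
    push Not at hall
    have : bad = Finset.univ := Finset.eq_univ_of_forall hall
    rw [this, Finset.card_univ] at hbad
    exact lt_irrefl _ hbad
  simp only [bad, R, Finset.mem_union, Finset.mem_biUnion, Finset.mem_filter, Finset.mem_univ,
    true_and, not_or, not_exists, not_and] at hα
  obtain ⟨⟨hD, hS⟩, hT⟩ := hα
  have hD' : a * α ^ 2 + b ≠ 0 := by simpa using hD
  obtain ⟨s, hs⟩ : ∃ s, s * (a * α ^ 2 + b) = -2 * (a * α + b) :=
    ⟨-2 * (a * α + b) / (a * α ^ 2 + b), div_mul_cancel₀ _ hD'⟩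
  -- the second intersection of the conic with the line in direction `(α, 1)` through `(1, 1)`
  refine ⟨1 + α * s, 1 + s, by linear_combination s * hs, fun h => hS _ h ?_, fun h => hT _ h ?_⟩
  · linear_combination α * hs
  · linear_combination hs

lemma mem_of_abs_mem {S : Finset ℤ} (hS : ∀ z ∈ S, -z ∈ S) {z : ℤ} (h : |z| ∈ S) : z ∈ S := by
  rcases abs_choice z with h' | h'
  · rwa [h'] at h
  · rw [h'] at h
    simpa using hS _ h

lemma two_mul_abs_le {M z : ℤ} (h1 : 2 * z ≤ M) (h2 : -M ≤ 2 * z) : 2 * |z| ≤ M := by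
  rcases abs_cases z with h | h <;> omega

/-- The residues modulo `M / 2` or `M` have small representatives, which are odd in the first
case. -/
lemma exists_small_rep {p : ℕ} [Fact p.Prime] {M : ℤ} (hp : p % 2 = 1) (hM : M = p ∨ M = 2 * p)
    (x : ZMod p) : ∃ z : ℤ, (z : ZMod p) = x ∧ 2 * |z| ≤ M ∧ (M = 2 * p → Odd z) := by
  have h1 : (x.valMinAbs : ZMod p) = x := ZMod.coe_valMinAbs x
  have h2 := ZMod.valMinAbs_mem_Ioc x
  simp only [Set.mem_Ioc] at h2
  generalize x.valMinAbs = z at h1 h2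
  have hp0 := (Fact.out : p.Prime).two_le
  rcases hM with rfl | rfl
  · exact ⟨z, h1, two_mul_abs_le (by omega) (by omega), fun h => by omega⟩
  · by_cases hz : z % 2 = 1
    · exact ⟨z, h1, two_mul_abs_le (by omega) (by omega), fun _ => Int.odd_iff.2 hz⟩
    · rcases le_or_gt z 0 with h0 | h0
      · exact ⟨z + p, by simpa using h1, two_mul_abs_le (by omega) (by omega),
          fun _ => Int.odd_iff.2 (by omega)⟩
      · exact ⟨z - p, by simpa using h1, two_mul_abs_le (by omega) (by omega),
          fun _ => Int.odd_iff.2 (by omega)⟩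

/-- Admissible classes with absolute values outside given symmetric sets, for `M = p` or
`M = 2 p`. -/
lemma exists_classes_avoiding {p : ℕ} [Fact p.Prime] {M a b : ℤ} (hp : p % 2 = 1)
    (hM : M = p ∨ M = 2 * p) (ha : ¬ (p : ℤ) ∣ a) (hb : ¬ (p : ℤ) ∣ b) (S T : Finset ℤ)
    (hS : ∀ z ∈ S, -z ∈ S) (hT : ∀ z ∈ T, -z ∈ T)
    (hcard : 2 * S.card + 2 * T.card + 2 < p) :
    ∃ z₁ z₂ A : ℤ, AdmissibleClass M a b |z₁| |z₂| A ∧ |z₁| ∉ S ∧ |z₂| ∉ T ∧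
      2 * |z₁| ≤ M ∧ 2 * |z₂| ≤ M := by
  have hne : ∀ n : ℤ, ¬ (p : ℤ) ∣ n → (n : ZMod p) ≠ 0 := fun n h h0 =>
    h ((ZMod.intCast_zmod_eq_zero_iff_dvd n p).1 h0)
  have h2 : (2 : ZMod p) ≠ 0 := by
    have := hne 2 (fun h => by
      have := Int.le_of_dvd (by norm_num) h
      have := (Fact.out : p.Prime).two_le
      omega)
    simpa using this
  obtain ⟨x, y, hxy, hx, hy⟩ := exists_conic_point_avoiding (hne a ha) (hne b hb) h2
    (S.image fun z : ℤ => (z : ZMod p)) (T.image fun z : ℤ => (z : ZMod p)) (by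
      have := Finset.card_image_le (s := S) (f := fun z : ℤ => (z : ZMod p))
      have := Finset.card_image_le (s := T) (f := fun z : ℤ => (z : ZMod p))
      rw [ZMod.card]
      omega)
  obtain ⟨z₁, hz₁, b₁, o₁⟩ := exists_small_rep hp hM x
  obtain ⟨z₂, hz₂, b₂, o₂⟩ := exists_small_rep hp hM y
  have hdvd : (p : ℤ) ∣ a * (z₁ * z₁ - 1) + b * (z₂ * z₂ - 1) := by
    rw [← ZMod.intCast_zmod_eq_zero_iff_dvd]
    push_cast
    rw [hz₁, hz₂]
    linear_combination hxy
  obtain ⟨A, hA⟩ : ∃ A, AdmissibleClass M a b |z₁| |z₂| A := by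
    refine exists_admissibleClass_abs ?_
    rcases hM with rfl | rfl
    · exact Or.inl ⟨by omega, hdvd⟩
    · refine Or.inr ⟨o₁ rfl, o₂ rfl, two_mul_dvd_of_odd (by omega) (o₁ rfl) (o₂ rfl) ?_⟩
      rwa [Int.mul_ediv_cancel_left _ two_ne_zero]
  refine ⟨z₁, z₂, A, hA, fun h => hx ?_, fun h => hy ?_, b₁, b₂⟩
  · exact Finset.mem_image.2 ⟨z₁, mem_of_abs_mem hS h, hz₁⟩
  · exact Finset.mem_image.2 ⟨z₂, mem_of_abs_mem hT h, hz₂⟩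

/-- The integers with absolute value in the interval from `x ≥ 0` to `y`. -/
noncomputable def absIcc (x y : ℤ) : Finset ℤ := Finset.Icc x y ∪ Finset.Icc (-y) (-x)

lemma mem_absIcc {x y z : ℤ} : z ∈ absIcc x y ↔ x ≤ z ∧ z ≤ y ∨ -y ≤ z ∧ z ≤ -x := by
  simp [absIcc]

lemma card_absIcc_le {x y : ℤ} {k : ℕ} (h : y - x < k) : (absIcc x y).card ≤ 2 * k := by
  have := Finset.card_union_le (Finset.Icc x y) (Finset.Icc (-y) (-x))
  rw [Int.card_Icc, Int.card_Icc] at this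
  unfold absIcc
  omega

/-- The case `p ∤ a b` of `M = p` or `M = 2 p`. -/
lemma false_of_prime {p : ℕ} [Fact p.Prime] {M a b c : ℤ} (H : RegularAtFractions M a b c)
    (ha0 : 0 < a) (hab : a ≤ b) (hbc : b ≤ c) (hp : p % 2 = 1)
    (hM : M = p ∧ 149 ≤ p ∨ M = 2 * p ∧ 359 ≤ p)
    (ha : ¬ (p : ℤ) ∣ a) (hb : ¬ (p : ℤ) ∣ b) : False := by
  have hM' : M = p ∨ M = 2 * p := by omega
  have hM149 : 149 ≤ M := by omega
  have hp2 := (Fact.out : p.Prime)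
  rcases le_total (5 * b) (8 * a) with hba | hba
  · -- the bound on `z₁` is `(p + 11) / 8`, whose square exceeds `(13 M + 5) / 5`
    obtain ⟨r, hr⟩ : ∃ r : ℕ, r = (p + 10) / 8 := ⟨_, rfl⟩
    obtain ⟨z₁, z₂, A, hA, h1, h2, b1, b2⟩ := exists_classes_avoiding hp hM' ha hb
      (Finset.Icc (-(r : ℤ)) r) (Finset.Icc (-2) 2) (by simp; omega) (by simp; omega) (by
        rw [Int.card_Icc, Int.card_Icc]
        omega)
    rw [Finset.mem_Icc] at h1 h2
    have p1 := abs_nonneg z₁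
    have p2 := abs_nonneg z₂
    have h1' : (r : ℤ) + 1 ≤ |z₁| := by omega
    have hsq : 13 * M + 5 ≤ 5 * (|z₁| * |z₁|) := by
      have h3 : (p : ℤ) + 11 ≤ 8 * |z₁| := by omega
      have h4 : ((p : ℤ) + 11) * (p + 11) ≤ 8 * |z₁| * (8 * |z₁|) :=
        mul_le_mul h3 h3 (by omega) (by omega)
      rcases hM with ⟨rfl, h5⟩ | ⟨rfl, h5⟩
      · have h6 : (149 : ℤ) ≤ p := by exact_mod_cast h5
        nlinarith [mul_le_mul_of_nonneg_right h6 (by omega : (0 : ℤ) ≤ p)]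
      · have h6 : (359 : ℤ) ≤ p := by exact_mod_cast h5
        nlinarith [mul_le_mul_of_nonneg_right h6 (by omega : (0 : ℤ) ≤ p)]
    exact hA.false_of_five_mul_le H (by omega) ha0 hab hbc hba (by omega) b1 hsq (by omega) b2
      (by omega)
  · obtain ⟨r, hr⟩ : ∃ r : ℕ, (r : ℤ) = max 5 (M / 20) := ⟨(max 5 (M / 20)).toNat, by omega⟩
    obtain ⟨z₁, z₂, A, hA, h1, h2, b1, b2⟩ := exists_classes_avoiding hp hM' ha hb
      (Finset.Icc (-8) 8 ∪ (absIcc ((M - 8) / 2) (M / 2) ∪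
        (absIcc ((M - 6) / 3) ((M + 6) / 3) ∪ absIcc ((M - 6) / 4) ((M + 6) / 4))))
      (Finset.Icc (-(r : ℤ)) r) (fun z hz => by
        simp only [Finset.mem_union, mem_absIcc, Finset.mem_Icc] at hz ⊢
        omega) (by simp; omega) (by
        have e1 := Finset.card_union_le (Finset.Icc (-8 : ℤ) 8) (absIcc ((M - 8) / 2) (M / 2) ∪
          (absIcc ((M - 6) / 3) ((M + 6) / 3) ∪ absIcc ((M - 6) / 4) ((M + 6) / 4)))
        have e2 := Finset.card_union_le (absIcc ((M - 8) / 2) (M / 2))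
          (absIcc ((M - 6) / 3) ((M + 6) / 3) ∪ absIcc ((M - 6) / 4) ((M + 6) / 4))
        have e3 := Finset.card_union_le (absIcc ((M - 6) / 3) ((M + 6) / 3))
          (absIcc ((M - 6) / 4) ((M + 6) / 4))
        have e4 := card_absIcc_le (x := (M - 8) / 2) (y := M / 2) (k := 5) (by omega)
        have e5 := card_absIcc_le (x := (M - 6) / 3) (y := (M + 6) / 3) (k := 5) (by omega)
        have e6 := card_absIcc_le (x := (M - 6) / 4) (y := (M + 6) / 4) (k := 4) (by omega)
        rw [Int.card_Icc] at e1 ⊢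
        omega)
    simp only [Finset.mem_union, mem_absIcc, Finset.mem_Icc, not_or] at h1 h2
    have p1 := abs_nonneg z₁
    have p2 := abs_nonneg z₂
    refine hA.false_of_eight_mul_le H (by omega) ha0 hbc hba (by omega) (by omega) (Or.inr ?_)
      (Or.inr ?_) (by omega) b2 (by omega)
    · rw [lt_abs]; omega
    · rw [lt_abs]; omega

/-! ### Existence of classes for every large `M` -/

lemma exists_dvd_and_dvd_add {r s : ℤ} (d : ℤ) (hr : 0 < r) (hs : 0 < s) (hcop : IsCoprime r s) :
    ∃ t, 0 ≤ t ∧ t < r * s ∧ r ∣ t ∧ s ∣ t + d := by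
  obtain ⟨u, v, huv⟩ := hcop
  refine ⟨(-(d * u * r)) % (r * s), Int.emod_nonneg _ (mul_pos hr hs).ne',
    Int.emod_lt_of_pos _ (mul_pos hr hs), ?_, ?_⟩
  · rw [Int.emod_def]
    exact ⟨-(d * u) - s * (-(d * u * r) / (r * s)), by ring⟩
  · rw [Int.emod_def]
    exact ⟨d * v - r * (-(d * u * r) / (r * s)), by linear_combination -d * huv⟩

/-- An odd `M` with two coprime factors: there is a class `t` with `M ∣ t (t + 2)`. -/
lemma false_of_coprime_factors_of_odd {M a b c r s : ℤ} (H : RegularAtFractions M a b c)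
    (ha : 0 < a) (hab : a ≤ b) (hbc : b ≤ c) (hM : 39 ≤ M) (hodd : M % 2 = 1) (hr : 1 < r)
    (hs : 1 < s) (hcop : IsCoprime r s) (hrs : M = r * s) : False := by
  obtain ⟨t, t0, tM, htr, hts⟩ := exists_dvd_and_dvd_add 2 (by omega) (by omega) hcop
  rw [← hrs] at tM
  have hdvd : M ∣ t * (t + 2) := by rw [hrs]; exact mul_dvd_mul htr hts
  have hs2 : ¬ s ∣ 2 := by
    intro h
    have h1 := Int.le_of_dvd (by norm_num) h
    obtain rfl : s = 2 := by omega
    omega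
  have hr2 : ¬ r ∣ 2 := by
    intro h
    have h1 := Int.le_of_dvd (by norm_num) h
    obtain rfl : r = 2 := by omega
    omega
  have htne : t ≠ 0 := by
    rintro rfl
    exact hs2 (by simpa using hts)
  have htne2 : t ≠ M - 2 := by
    rintro rfl
    have : r ∣ M := ⟨s, hrs⟩
    exact hr2 (by simpa using dvd_sub this htr)
  have htne1 : t ≠ M - 1 := by
    rintro rfl
    have : s ∣ M := ⟨r, by rw [hrs]; ring⟩
    have := dvd_sub hts this
    rw [show M - 1 + 2 - M = 1 by ring] at this
    have := Int.le_of_dvd (by norm_num) this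
    omega
  -- the involution `t ↦ M - 2 - t` allows to assume that `t` is small
  have main : ∀ t : ℤ, 0 < t → 2 * t ≤ M - 2 → M ∣ t * (t + 2) → False := by
    intro t t0 tM hd
    have h3 : 2 * t ≠ M - 3 := by
      intro h3
      have h4 : M ∣ 4 * (t * (t + 2)) := Dvd.dvd.mul_left hd 4
      rw [show 4 * (t * (t + 2)) = (2 * t) * (2 * t + 4) by ring, h3] at h4
      have h5 := dvd_sub (Dvd.intro (M - 2) rfl : M ∣ M * (M - 2)) h4
      rw [show M * (M - 2) - (M - 3) * (M - 3 + 4) = 3 by ring] at h5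
      have := Int.le_of_dvd (by norm_num) h5
      omega
    have hlow : M ≤ t * (t + 2) := Int.le_of_dvd (by positivity) hd
    have h2 : (2 : ℤ) ∣ t * (M - 2 - t) := by
      apply Even.two_dvd
      rw [Int.even_mul, Int.even_iff, Int.even_iff]
      omega
    have hM' : M ∣ t * (M - 2 - t) := by
      obtain ⟨k, hk⟩ := hd
      exact ⟨t - k, by linear_combination -hk⟩
    have hcop : IsCoprime (2 : ℤ) M := ⟨-(M / 2), 1, by omega⟩
    obtain ⟨q, hq⟩ := hcop.mul_dvd h2 hM'
    exact false_of_single_class (q := a * q) hM ha hab hbc H (by nlinarith) (by omega) hlow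
      (by omega) (by rw [hq]; ring)
  rcases le_or_gt (2 * t) (M - 2) with h | h
  · exact main t (by omega) h hdvd
  · refine main (M - 2 - t) (by omega) (by omega) ?_
    obtain ⟨k, hk⟩ := hdvd
    exact ⟨M - 2 - 2 * t + k, by linear_combination hk⟩

/-- An even `M` such that `M / 2` has two coprime factors: there is a class `2 t` with
`M / 2 ∣ t (t + 1)`. -/
lemma false_of_coprime_factors_of_even {M a b c r s : ℤ} (H : RegularAtFractions M a b c)
    (ha : 0 < a) (hab : a ≤ b) (hbc : b ≤ c) (hM : 39 ≤ M) (hr : 1 < r)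
    (hs : 1 < s) (hcop : IsCoprime r s) (hrs : M = 2 * (r * s)) : False := by
  obtain ⟨N, hN⟩ : ∃ N, N = r * s := ⟨_, rfl⟩
  obtain ⟨t, t0, tM, htr, hts⟩ := exists_dvd_and_dvd_add 1 (by omega) (by omega) hcop
  rw [← hN] at tM hrs
  have hdvd : N ∣ t * (t + 1) := by rw [hN]; exact mul_dvd_mul htr hts
  have hs2 : ¬ s ∣ 1 := fun h => by
    have := Int.le_of_dvd (by norm_num) h
    omega
  have hr2 : ¬ r ∣ 1 := fun h => by
    have := Int.le_of_dvd (by norm_num) h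
    omega
  have htne : t ≠ 0 := by
    rintro rfl
    exact hs2 (by simpa using hts)
  have htne2 : t ≠ N - 1 := by
    rintro rfl
    have : r ∣ N := ⟨s, hN⟩
    exact hr2 (by simpa using dvd_sub this htr)
  have main : ∀ t : ℤ, 0 < t → 2 * t ≤ N - 1 → N ∣ t * (t + 1) → False := by
    intro t t0 tM hd
    have h3 : 2 * t ≠ N - 1 := by
      intro h3
      have h4 : N ∣ 4 * (t * (t + 1)) := Dvd.dvd.mul_left hd 4
      rw [show 4 * (t * (t + 1)) = (2 * t) * (2 * t + 2) by ring, h3] at h4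
      have h5 := dvd_sub (Dvd.intro N rfl : N ∣ N * N) h4
      rw [show N * N - (N - 1) * (N - 1 + 2) = 1 by ring] at h5
      have := Int.le_of_dvd (by norm_num) h5
      omega
    have hlow : N ≤ t * (t + 1) := Int.le_of_dvd (by positivity) hd
    obtain ⟨k, hk⟩ := hd
    refine false_of_single_class (t := 2 * t) (q := a * (t - k)) hM ha hab hbc H (by omega)
      (by omega) ?_ (fun _ => even_two_mul t) ?_
    · rw [hrs]; linarith
    · rw [hrs]; linear_combination 4 * a * hk
  rcases le_or_gt (2 * t) (N - 1) with h | h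
  · exact main t (by omega) h hdvd
  · refine main (N - 1 - t) (by omega) (by omega) ?_
    obtain ⟨k, hk⟩ := hdvd
    exact ⟨N - 1 - 2 * t + k, by linear_combination hk⟩

/-- If `M ∣ a t`, then `a P_m` alone takes integral values at the class of `t / M`. -/
lemma false_of_dvd_first {M a b c t : ℤ} (H : RegularAtFractions M a b c)
    (ha : 0 < a) (hab : a ≤ b) (hbc : b ≤ c) (hM : 39 ≤ M) (ht : 2 ≤ t) (htM : 2 * t ≤ M - 4)
    (hlow : M ≤ t * (t + 2)) (hpar : M % 2 = 0 → t % 2 = 0) (hd : M ∣ a * t) : False := by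
  have h2M : 2 * M ∣ a * (t * (M - 2 - t)) := by
    rcases Int.emod_two_eq_zero_or_one M with h0 | h0
    · obtain ⟨k, hk⟩ := hd
      obtain ⟨y, hy⟩ : ∃ y, M - 2 - t = 2 * y := ⟨(M - 2 - t) / 2, by omega⟩
      exact ⟨k * y, by rw [hy]; linear_combination 2 * y * hk⟩
    · have h2 : (2 : ℤ) ∣ a * (t * (M - 2 - t)) := by
        refine Dvd.dvd.mul_left (Even.two_dvd ?_) a
        rw [Int.even_mul, Int.even_iff, Int.even_iff]
        omega
      have hcop : IsCoprime (2 : ℤ) M := ⟨-(M / 2), 1, by omega⟩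
      exact hcop.mul_dvd h2 (by rw [← mul_assoc]; exact Dvd.dvd.mul_right hd _)
  obtain ⟨q, hq⟩ := h2M
  exact false_of_single_class hM ha hab hbc H ht htM hlow
    (fun h => Int.even_iff.2 (hpar (by omega))) hq.symm

/-- The case where `b` is divisible by a divisor `r = M / x` of `M` with small cofactor. -/
lemma false_of_dvd_second {M a b c r x s₁ s₂ : ℤ} (H : RegularAtFractions M a (r * b) c)
    (ha : 0 < a) (hb : 0 < b) (hab : a ≤ r * b) (hbc : r * b ≤ c) (hM : 131 ≤ M ∨ M = 81)
    (hx : M = r * x) (hx0 : 0 < x) (hpar : M % 2 = x % 2)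
    (h1 : 4 * M < x * (s₁ * (M - 2 + s₁ * x)))
    (h12 : x * (s₁ * (M - 2 + s₁ * x)) + 2 * M < x * (s₂ * (M - 2 + s₂ * x)))
    (h2 : x * (s₂ * (M - 2 + s₂ * x)) * (11 * M - 2) < 2 * M * ((M - 1) * (M - 2))) : False := by
  have ev : ∀ s, ∃ y, s * (M - 2 + s * x) = 2 * y := by
    intro s
    have : Even (s * (M - 2 + s * x)) := by
      rw [Int.even_mul, Int.even_add, Int.even_mul, Int.even_iff, Int.even_iff, Int.even_iff]
      omega
    exact this.two_dvd
  obtain ⟨y₁, hy₁⟩ := ev s₁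
  obtain ⟨y₂, hy₂⟩ := ev s₂
  rw [hy₁] at h1 h12
  rw [hy₂] at h12 h2
  have hodd : ∀ s, M % 4 = 2 → Odd (1 - s * x) := by
    intro s h4
    obtain ⟨x', rfl⟩ : ∃ x', x = 2 * x' := ⟨x / 2, by omega⟩
    exact ⟨-(s * x'), by ring⟩
  refine false_of_second_class (w₁ := 1 - s₁ * x) (w₂ := 1 - s₂ * x) (N₁ := b * y₁) (N₂ := b * y₂)
    hM ha hab hbc H (hodd s₁) (hodd s₂) ?_ ?_ ?_ ?_ ?_
  · rw [hx] at hy₁ ⊢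
    linear_combination r * b * x * hy₁
  · rw [hx] at hy₂ ⊢
    linear_combination r * b * x * hy₂
  · refine lt_of_mul_lt_mul_left (a := 2 * x) ?_ (by omega)
    have := mul_lt_mul_of_pos_left h1 hb
    rw [hx] at this
    linarith
  · refine lt_of_mul_lt_mul_left (a := 2 * x) ?_ (by omega)
    have := mul_lt_mul_of_pos_left h12 hb
    have e : 2 * x * (b * y₁ + r * b) = b * (x * (2 * y₁) + 2 * M) := by rw [hx]; ring
    rw [e]
    linarith
  · refine lt_of_mul_lt_mul_left (a := 2 * x) ?_ (by omega)
    have := mul_lt_mul_of_pos_left h2 hb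
    have e : 2 * x * (r * b * ((M - 1) * (M - 2))) = b * (2 * M * ((M - 1) * (M - 2))) := by
      rw [hx]; ring
    rw [e]
    linarith

/-- For cofactors `x` between `5` and `M / 13`, the numerators `1 - x` and `1 - 2 x` work. -/
lemma false_of_dvd_second_of_le {M a b c r x : ℤ} (H : RegularAtFractions M a (r * b) c)
    (ha : 0 < a) (hb : 0 < b) (hab : a ≤ r * b) (hbc : r * b ≤ c) (hM : 131 ≤ M)
    (hx : M = r * x) (hx0 : 5 ≤ x) (hpar : M % 2 = x % 2) (hxM : 13 * x ≤ M) : False := by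
  refine false_of_dvd_second (s₁ := 1) (s₂ := 2) H ha hb hab hbc (Or.inl hM) hx (by omega) hpar
    ?_ ?_ ?_
  · nlinarith
  · nlinarith
  · have e1 : x * (2 * (M - 2 + 2 * x)) * 169 ≤ M * (2 * (15 * M - 26)) := by
      have h1 : 13 * (M - 2 + 2 * x) ≤ 15 * M - 26 := by omega
      have := mul_le_mul hxM h1 (by omega) (by omega)
      nlinarith
    have e2 := mul_le_mul_of_nonneg_right e1 (by omega : 0 ≤ 11 * M - 2)
    have e3 : (15 * M - 26) * (11 * M - 2) < 169 * ((M - 1) * (M - 2)) := by nlinarith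
    have e4 := mul_lt_mul_of_pos_left e3 (by omega : 0 < 2 * M)
    nlinarith

/-- The conditions on the first class for `1 + 2 M / p`, `p ≥ 5`. -/
lemma two_step_of_five_le {M p u : ℤ} (hM : M = p * u) (hp : 5 ≤ p) (hp6 : p ≠ 6) (hp8 : p ≠ 8)
    (hpu : p ≤ u) (hu : 13 ≤ u) : 13 * M + 5 ≤ 5 * (|1 + 2 * u| * |1 + 2 * u|) ∧
      8 < M - 2 * |1 + 2 * u| ∧ (3 * |1 + 2 * u| - M = 3 ∨ 6 < |3 * |1 + 2 * u| - M|) ∧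
      (4 * |1 + 2 * u| - M = 4 ∨ 6 < |4 * |1 + 2 * u| - M|) := by
  rw [abs_of_pos (by omega : 0 < 1 + 2 * u)]
  have h5 : 5 * u ≤ p * u := mul_le_mul_of_nonneg_right hp (by omega)
  refine ⟨by nlinarith [mul_le_mul_of_nonneg_right hpu (by omega : 0 ≤ u)], by omega, ?_, ?_⟩
  · right
    exact dist_ge_of_ne (p := p) (u := u) (x := 6) (ε := 3) (by omega) (Ne.symm hp6)
      (by rw [hM]; ring) (by norm_num; omega)
  · right
    exact dist_ge_of_ne (p := p) (u := u) (x := 8) (ε := 4) (by omega) (Ne.symm hp8)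
      (by rw [hM]; ring) (by norm_num; omega)

/-- The conditions on the first class for `1 + M / 3` and `1 + M / 4`. -/
lemma one_step_of_three_or_four {M d u : ℤ} (hM : M = d * u) (hd : d = 3 ∨ d = 4)
    (hu : 27 ≤ u) : 13 * M + 5 ≤ 5 * (|1 + 1 * u| * |1 + 1 * u|) ∧
      8 < M - 2 * |1 + 1 * u| ∧ (3 * |1 + 1 * u| - M = 3 ∨ 6 < |3 * |1 + 1 * u| - M|) ∧
      (4 * |1 + 1 * u| - M = 4 ∨ 6 < |4 * |1 + 1 * u| - M|) := by
  rw [abs_of_pos (by omega : 0 < 1 + 1 * u), lt_abs, lt_abs]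
  rcases hd with rfl | rfl
  · exact ⟨by nlinarith, by omega, by omega, by omega⟩
  · exact ⟨by nlinarith, by omega, by omega, by omega⟩

lemma exists_eq_pow_mul {p : ℕ} (hp : p.Prime) {b : ℤ} (hb : 0 < b) :
    ∃ (i : ℕ) (b' : ℤ), b = (p : ℤ) ^ i * b' ∧ ¬ (p : ℤ) ∣ b' ∧ 0 < b' := by
  have hfin : FiniteMultiplicity (p : ℤ) b :=
    Int.finiteMultiplicity_iff.2 ⟨by simpa using hp.one_lt.ne', hb.ne'⟩
  obtain ⟨b', h1, h2⟩ := hfin.exists_eq_pow_mul_and_not_dvd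
  refine ⟨_, b', h1, h2, ?_⟩
  have hpp : (0 : ℤ) < (p : ℤ) ^ multiplicity (p : ℤ) b := pow_pos (by exact_mod_cast hp.pos) _
  rw [h1] at hb
  by_contra h
  exact absurd hb (not_lt.2 (mul_nonpos_of_nonneg_of_nonpos hpp.le (not_lt.1 h)))

/-- The powers of an odd prime and their doubles. -/
lemma false_of_odd_prime_pow {p e : ℕ} {M δ a b c : ℤ} (H : RegularAtFractions M a b c)
    (ha : 0 < a) (hab : a ≤ b) (hbc : b ≤ c) (hp : p.Prime) (hpo : p % 2 = 1) (he : e ≠ 0)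
    (hδ : δ = 1 ∨ δ = 2) (hM : M = δ * (p : ℤ) ^ e)
    (hM3 : p = 3 → δ = 1 ∧ 81 ≤ M ∨ δ = 2 ∧ 486 ≤ M)
    (hM5 : 5 ≤ p → δ = 1 ∧ 149 ≤ M ∨ δ = 2 ∧ 718 ≤ M) : False := by
  have : Fact p.Prime := ⟨hp⟩
  have hpI : Prime (p : ℤ) := Nat.prime_iff_prime_int.1 hp
  have hb : 0 < b := by omega
  have hp35 : p = 3 ∨ 5 ≤ p := by
    have := hp.two_le
    rcases Nat.lt_or_ge p 5 with h | h
    · left; interval_cases p <;> omega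
    · exact Or.inr h
  have hM39 : 81 ≤ M := by
    rcases hp35 with h | h
    · have := hM3 h; omega
    · have := hM5 h; omega
  have hpow_odd : ∀ k, ((p : ℤ) ^ k) % 2 = 1 := fun k =>
    Int.odd_iff.1 (Odd.pow (Int.odd_iff.2 (by omega)))
  have hδp : ∀ k, δ * (p : ℤ) ^ k % 2 = δ % 2 := fun k => by
    have := hpow_odd k
    rcases hδ with rfl | rfl <;> omega
  have hMpar : M % 2 = δ % 2 := by rw [hM]; exact hδp e
  obtain ⟨n, rfl⟩ : ∃ n, e = n + 1 := ⟨e - 1, by omega⟩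
  have hp3 : 3 ≤ (p : ℤ) := by omega
  obtain ⟨u, hu⟩ : ∃ u, u = δ * (p : ℤ) ^ n := ⟨_, rfl⟩
  have hMu : M = p * u := by rw [hM, hu]; ring
  have hu0 : 0 < u := by
    by_contra h
    nlinarith
  have hupar : u % 2 = δ % 2 := by rw [hu]; exact hδp n
  by_cases hpa : (p : ℤ) ∣ a
  · obtain ⟨a', rfl⟩ := hpa
    rcases Nat.eq_zero_or_pos n with hn | hn
    · -- `M = p` or `M = 2 p`: any class will do
      subst hn
      rw [pow_zero, mul_one] at hu
      have hMp : M = δ * p := by rw [hMu, hu]; ring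
      have hd : M ∣ p * a' * (δ * (p / 3)) := ⟨a' * (p / 3), by rw [hMu, hu]; ring⟩
      have h5 : 5 ≤ p := by
        rcases hp35 with rfl | h
        · omega
        · exact h
      have := hM5 h5
      have hlow : M ≤ δ * (p / 3) * (δ * (p / 3) + 2) := by
        have h1 : M ≤ 3 * (δ * (p / 3)) + 4 := by
          rcases hδ with rfl | rfl <;> omega
        nlinarith
      exact false_of_dvd_first H ha hab hbc (by omega)
        (by rcases hδ with rfl | rfl <;> omega) (by rcases hδ with rfl | rfl <;> omega)
        hlow (fun h => by rcases hδ with rfl | rfl <;> omega) hd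
    · have hd : M ∣ p * a' * u := ⟨a', by rw [hMu]; ring⟩
      have hpu : (p : ℤ) ≤ u := by
        refine Int.le_of_dvd hu0 ?_
        rw [hu]
        exact Dvd.dvd.mul_left (dvd_pow_self _ (by omega)) _
      have h3u : 3 * u ≤ p * u := mul_le_mul_of_nonneg_right hp3 (by omega)
      exact false_of_dvd_first H ha hab hbc (by omega) (by omega) (by omega)
        (by rw [hMu]; nlinarith) (fun h => by omega) hd
  obtain ⟨i, b', rfl, hpb', hb'⟩ := exists_eq_pow_mul hp hb
  rcases Nat.eq_zero_or_pos n with hn | hn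
  · subst hn
    rw [pow_zero, mul_one] at hu
    have h5 : 5 ≤ p := by
      rcases hp35 with rfl | h
      · omega
      · exact h
    have hM5' := hM5 h5
    have hMp : M = δ * p := by rw [hMu, hu]; ring
    rcases Nat.eq_zero_or_pos i with hi | hi
    · refine false_of_prime (p := p) H ha hab hbc hpo ?_ hpa ?_
      · rcases hδ with rfl | rfl <;> omega
      · rw [hi, pow_zero, one_mul]; exact hpb'
    · obtain ⟨j, rfl⟩ : ∃ j, i = j + 1 := ⟨i - 1, by omega⟩
      have hbe : (p : ℤ) ^ (j + 1) * b' = p * ((p : ℤ) ^ j * b') := by ring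
      rw [hbe] at H hab hbc
      have hb'' : 0 < (p : ℤ) ^ j * b' := by positivity
      subst hu
      refine false_of_dvd_second (s₁ := 5) (s₂ := 8) H ha hb'' hab hbc (by omega) hMu hu0
        (by omega) ?_ ?_ ?_
      · rcases hδ with rfl | rfl <;> omega
      · rcases hδ with rfl | rfl <;> omega
      · rcases hδ with rfl | rfl
        · have h149 : 0 ≤ M - 149 := by omega
          nlinarith [mul_nonneg h149 h149, mul_nonneg (by omega : 0 ≤ M) (mul_nonneg h149 h149)]
        · have h718 : 0 ≤ M - 718 := by omega
          nlinarith [mul_nonneg h718 h718, mul_nonneg (by omega : 0 ≤ M) (mul_nonneg h718 h718)]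
  -- from here on, `p²` divides `M`
  have h13 : 5 ≤ p → 13 ≤ (p : ℤ) ^ n := by
    intro h5
    have h5' : (5 : ℤ) ≤ p := by exact_mod_cast h5
    have hM5' := hM5 h5
    rcases Nat.lt_or_ge n 2 with h | h
    · obtain rfl : n = 1 := by omega
      rw [pow_one]
      have : 149 ≤ (p : ℤ) ^ (1 + 1) := by rcases hδ with rfl | rfl <;> omega
      nlinarith
    · calc (13 : ℤ) ≤ 5 ^ 2 := by norm_num
        _ ≤ (p : ℤ) ^ 2 := pow_le_pow_left₀ (by norm_num) h5' 2
        _ ≤ (p : ℤ) ^ n := pow_le_pow_right₀ (by omega) h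
  have hu13 : 5 ≤ p → 13 ≤ u := fun h5 => by
    have := h13 h5
    rw [hu]
    rcases hδ with rfl | rfl <;> omega
  have hM131 : M = 81 ∧ p = 3 ∧ δ = 1 ∨ 131 ≤ M := by
    rcases hp35 with h | h
    · rcases Nat.lt_or_ge n 4 with h4 | h4
      · have := hM3 h
        rcases this with h1 | h1
        · left
          subst h
          obtain ⟨rfl, h1⟩ := h1
          interval_cases n <;> norm_num at hM <;> omega
        · right; omega
      · right
        have : (3 : ℤ) ^ 5 ≤ (p : ℤ) ^ (n + 1) := by
          rw [h]
          exact pow_le_pow_right₀ (by norm_num) (by omega)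
        rcases hδ with rfl | rfl <;> omega
    · have := hM5 h; omega
  rcases Nat.lt_or_ge i n with hin | hin
  · -- `M / p` does not divide `b`
    obtain ⟨j, hj⟩ : ∃ j, n = i + (j + 1) := ⟨n - i - 1, by omega⟩
    obtain ⟨Q, hQ⟩ : ∃ Q, Q = δ * (p : ℤ) ^ (j + 1) := ⟨_, rfl⟩
    have huQ : u = (p : ℤ) ^ i * Q := by rw [hu, hQ, hj]; ring
    have hMQ : M = p * ((p : ℤ) ^ i * Q) := by rw [hMu, huQ]
    have hpQ : (p : ℤ) ∣ Q := by
      rw [hQ]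
      exact Dvd.dvd.mul_left (dvd_pow_self _ (by omega)) _
    have hpQ2 : M % 2 = 0 → 2 * (p : ℤ) ∣ Q := by
      intro h0
      obtain rfl : δ = 2 := by omega
      rw [hQ]
      exact mul_dvd_mul_left 2 (dvd_pow_self _ (by omega))
    have hQ0 : 0 < Q := by
      rw [hQ]
      rcases hδ with rfl | rfl <;> positivity
    have hcopb : IsCoprime b' (p : ℤ) := (hpI.coprime_iff_not_dvd.2 hpb').symm
    have hcopa : IsCoprime a (p : ℤ) := (hpI.coprime_iff_not_dvd.2 hpa).symm
    have hpi : i ≠ 0 → 3 ≤ (p : ℤ) ^ i := fun hi =>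
      hp3.trans (le_self_pow₀ (by omega) hi)
    rcases hp35 with h3 | h5
    · have h3' : (p : ℤ) = 3 := by exact_mod_cast h3
      have hM3Q : M = 3 * ((p : ℤ) ^ i * Q) := by rw [hMQ, h3']
      have hu27 : 27 ≤ (p : ℤ) ^ i * Q := by omega
      obtain ⟨c1, c2, c3, c4⟩ := one_step_of_three_or_four hMQ (Or.inl h3') hu27
      have hM' : 131 ≤ M ∨ (M = 81 ∧ |1 + 1 * ((p : ℤ) ^ i * Q)| = 28) := by
        rcases hM131 with h | h
        · right
          refine ⟨h.1, ?_⟩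
          rw [abs_of_pos (by omega)]
          omega
        · exact Or.inl h
      by_cases hi : i = 0
      · exact false_of_lift_of_le_two H ha hab hbc hM' hMQ hpQ hpQ2 (Or.inl h3')
          (Or.inl (by rw [hi, pow_zero])) hcopa hcopb c1 c2 c3 c4
      · exact false_of_lift_of_three_le H ha hab hbc hM' hMQ hpQ hpQ2 (by omega) hQ0 (hpi hi)
          hcopb c1 c2 c3 c4
    · have h5' : (5 : ℤ) ≤ p := by exact_mod_cast h5
      have hM' : 131 ≤ M := by
        rcases hM131 with h | h
        · omega
        · exact h
      have hpu : (p : ℤ) ≤ u := by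
        refine Int.le_of_dvd hu0 ?_
        rw [huQ]
        exact Dvd.dvd.mul_left hpQ _
      by_cases hi : i = 0
      · rw [hi, pow_zero, one_mul] at H hab hbc hMQ huQ
        exact false_of_lift_one H ha hab hbc hM' hMQ hpI h5' (by omega) hpQ hpQ2
          (by have := hu13 h5; omega) hpa hpb'
      · have := hu13 h5
        rw [huQ] at hpu this
        obtain ⟨c1, c2, c3, c4⟩ := two_step_of_five_le hMQ h5' (by omega) (by omega) hpu this
        exact false_of_lift_of_three_le H ha hab hbc (Or.inl hM') hMQ hpQ hpQ2 (by omega) hQ0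
          (hpi hi) hcopb c1 c2 c3 c4
  · obtain ⟨j, rfl⟩ : ∃ j, i = n + j := ⟨i - n, by omega⟩
    have hbe : (p : ℤ) ^ (n + j) * b' = (p : ℤ) ^ n * ((p : ℤ) ^ j * b') := by ring
    rw [hbe] at H hab hbc
    have hb'' : 0 < (p : ℤ) ^ j * b' := by positivity
    have hMx : M = (p : ℤ) ^ n * (δ * p) := by rw [hM]; ring
    have hxpar : M % 2 = (δ * p) % 2 := by
      have := hδp 1
      rw [pow_one] at this
      omega
    rcases hp35 with h3 | h5
    · have h3' : (p : ℤ) = 3 := by exact_mod_cast h3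
      have := hM3 h3
      rw [h3'] at H hab hbc hMx hxpar hb''
      rcases hδ with rfl | rfl
      · refine false_of_dvd_second (s₁ := 2) (s₂ := 4) H ha hb'' hab hbc (by omega) hMx
          (by norm_num) hxpar ?_ ?_ ?_
        · omega
        · omega
        · nlinarith [mul_nonneg (by omega : 0 ≤ M - 81) (by omega : 0 ≤ M - 81),
            mul_nonneg (by omega : 0 ≤ M) (mul_nonneg (by omega : 0 ≤ M - 81)
              (by omega : 0 ≤ M - 81))]
      · exact false_of_dvd_second_of_le H ha hb'' hab hbc (by omega) hMx (by norm_num) hxpar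
          (by omega)
    · have h5' : (5 : ℤ) ≤ p := by exact_mod_cast h5
      have hM5' := hM5 h5
      refine false_of_dvd_second_of_le H ha hb'' hab hbc (by omega) hMx ?_ hxpar ?_
      · rcases hδ with rfl | rfl <;> omega
      · rw [hMx]
        exact mul_le_mul_of_nonneg_right (h13 h5) (by rcases hδ with rfl | rfl <;> omega)

/-- The powers of `2`. -/
lemma false_of_two_pow {e : ℕ} {M a b c : ℤ} (H : RegularAtFractions M a b c)
    (ha : 0 < a) (hab : a ≤ b) (hbc : b ≤ c) (he : 8 ≤ e) (hM : M = 2 ^ e) : False := by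
  obtain ⟨n, rfl⟩ : ∃ n, e = n + 4 := ⟨e - 4, by omega⟩
  have hMn : M = 2 ^ n * 16 := by rw [hM]; ring
  have hn16 : (16 : ℤ) ≤ 2 ^ n := by
    calc (16 : ℤ) = 2 ^ 4 := by norm_num
      _ ≤ 2 ^ n := pow_le_pow_right₀ (by norm_num) (by omega)
  by_cases h2a : (2 : ℤ) ∣ a
  · obtain ⟨a', rfl⟩ := h2a
    obtain ⟨r, hr⟩ : ∃ r : ℤ, r = 2 ^ n := ⟨_, rfl⟩
    rw [← hr] at hMn hn16
    refine false_of_single_class (t := 8 * r - 2) (q := a' * (4 * r - 1)) (by omega) ha hab hbc H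
      (by omega) (by omega) (by nlinarith) (by omega) ?_
    rw [hMn]
    ring
  obtain ⟨i, b', rfl, h2b', hb'⟩ := exists_eq_pow_mul Nat.prime_two (b := b) (by omega)
  simp only [Nat.cast_ofNat] at H hab hbc h2b'
  rcases Nat.lt_or_ge i n with hin | hin
  · obtain ⟨j, hj⟩ : ∃ j, n = i + (j + 1) := ⟨n - i - 1, by omega⟩
    obtain ⟨Q, hQ⟩ : ∃ Q : ℤ, Q = 2 ^ j * 8 := ⟨_, rfl⟩
    have huQ : 2 ^ n * 4 = 2 ^ i * Q := by rw [hQ, hj]; ring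
    have hMQ : M = 4 * (2 ^ i * Q) := by rw [hMn, ← huQ]; ring
    have h8 : (2 : ℤ) * 4 ∣ Q := ⟨2 ^ j, by rw [hQ]; ring⟩
    have h4 : (4 : ℤ) ∣ Q := (Dvd.intro_left 2 rfl).trans h8
    have hQ0 : 0 < Q := by rw [hQ]; positivity
    have hcop : ∀ x : ℤ, ¬ (2 : ℤ) ∣ x → IsCoprime x 4 := by
      intro x hx
      have : IsCoprime x 2 := (Int.prime_two.coprime_iff_not_dvd.2 hx).symm
      have := this.pow_right (n := 2)
      norm_num at this
      exact this
    obtain ⟨c1, c2, c3, c4⟩ := one_step_of_three_or_four hMQ (Or.inr rfl) (by omega)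
    rcases Nat.lt_or_ge i 2 with hi | hi
    · exact false_of_lift_of_le_two H ha hab hbc (Or.inl (by omega)) hMQ h4 (fun _ => h8)
        (Or.inr rfl) (by interval_cases i <;> simp) (hcop a h2a) (hcop b' h2b') c1 c2 c3 c4
    · have hf : (3 : ℤ) ≤ 2 ^ i := by
        calc (3 : ℤ) ≤ 2 ^ 2 := by norm_num
          _ ≤ 2 ^ i := pow_le_pow_right₀ (by norm_num) hi
      exact false_of_lift_of_three_le H ha hab hbc (Or.inl (by omega)) hMQ h4 (fun _ => h8)
        (by norm_num) hQ0 hf (hcop b' h2b') c1 c2 c3 c4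
  · obtain ⟨j, rfl⟩ : ∃ j, i = n + j := ⟨i - n, by omega⟩
    have hbe : (2 : ℤ) ^ (n + j) * b' = 2 ^ n * (2 ^ j * b') := by ring
    rw [hbe] at H hab hbc
    exact false_of_dvd_second_of_le H ha (by positivity) hab hbc (by omega) hMn (by norm_num)
      (by omega) (by omega)

lemma prime_pow_or_coprime_factors {N : ℕ} (hN : 2 ≤ N) :
    (∃ p e : ℕ, p.Prime ∧ e ≠ 0 ∧ N = p ^ e) ∨
      ∃ r s : ℕ, 1 < r ∧ 1 < s ∧ Nat.Coprime r s ∧ N = r * s := by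
  have hp := Nat.minFac_prime (by omega : N ≠ 1)
  obtain ⟨e, s, hs, hN'⟩ := Nat.exists_eq_pow_mul_and_not_dvd (by omega : N ≠ 0) N.minFac hp.ne_one
  have he : e ≠ 0 := by
    rintro rfl
    rw [pow_zero, one_mul] at hN'
    exact hs (hN' ▸ Nat.minFac_dvd N)
  have hs0 : s ≠ 0 := by
    rintro rfl
    exact hs (dvd_zero _)
  by_cases hs1 : s = 1
  · exact Or.inl ⟨_, e, hp, he, by rw [hs1, mul_one] at hN'; exact hN'⟩
  · exact Or.inr ⟨_, s, Nat.one_lt_pow he hp.one_lt, by omega,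
      ((Nat.Prime.coprime_iff_not_dvd hp).2 hs).pow_left e, hN'⟩

/-- The bounds of the theorem, for `M = m - 2`. The prime powers beyond `39` that are divisible
by `3` are `81, 243, …`; this is why smaller bounds suffice if `3 ∣ M`. -/
lemma false_of_large {M : ℕ} {a b c : ℤ} (H : RegularAtFractions M a b c)
    (ha : 0 < a) (hab : a ≤ b) (hbc : b ≤ c)
    (hM : M % 2 = 1 ∧ (M % 3 = 0 ∧ 39 ≤ M ∨ 149 ≤ M) ∨
      M % 4 = 2 ∧ (M % 3 = 0 ∧ 198 ≤ M ∨ 718 ≤ M) ∨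
      M % 4 = 0 ∧ (M % 3 = 0 ∧ 48 ≤ M ∨ 148 ≤ M)) : False := by
  have three_of : ∀ {p e : ℕ}, p.Prime → e ≠ 0 → p ^ e % 3 = 0 → p = 3 := by
    intro p e hp he h
    exact ((Nat.prime_dvd_prime_iff_eq Nat.prime_three hp).1
      (Nat.prime_three.dvd_of_dvd_pow (Nat.dvd_of_mod_eq_zero h))).symm
  have pow_three : ∀ {e : ℕ} (k : ℕ), 3 ^ k < 3 ^ e → 3 ^ (k + 1) ≤ 3 ^ e := fun {e} k h =>
    Nat.pow_le_pow_right (by norm_num) ((Nat.pow_lt_pow_iff_right (by norm_num)).1 h)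
  rcases Nat.mod_two_eq_zero_or_one M with h2 | h2
  · obtain ⟨N, hN⟩ : ∃ N, M = 2 * N := ⟨M / 2, by omega⟩
    rcases prime_pow_or_coprime_factors (by omega : 2 ≤ N) with ⟨p, e, hp, he, hpe⟩ |
      ⟨r, s, hr, hs, hcop, hrs⟩
    · rcases hp.eq_two_or_odd with rfl | hpo
      · have hMe : M = 2 ^ (e + 1) := by rw [hN, hpe]; ring
        have he8 : 8 ≤ e + 1 := by
          by_contra hlt
          have : 2 ^ (e + 1) ≤ 2 ^ 7 := Nat.pow_le_pow_right (by norm_num) (by omega)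
          have h3 : M % 3 = 0 := by omega
          rw [hMe] at h3
          have := three_of Nat.prime_two (by omega) h3
          omega
        exact false_of_two_pow H ha hab hbc he8 (by rw [hMe]; push_cast; ring)
      · have hodd : p ^ e % 2 = 1 := Nat.odd_iff.1 (Odd.pow (Nat.odd_iff.2 hpo))
        have h3e : M % 3 = 0 → p = 3 := fun h => three_of hp he (by omega)
        have h5p : 5 ≤ p → 718 ≤ M := by
          intro h5
          have : M % 3 ≠ 0 := fun h => by have := h3e h; omega
          omega
        have h3p : p = 3 → 486 ≤ M := by
          rintro rfl
          have := pow_three (e := e) 4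
          norm_num at this
          omega
        refine false_of_odd_prime_pow (δ := 2) H ha hab hbc hp hpo he (Or.inr rfl)
          (by rw [hN, hpe]; push_cast; ring) (fun h => Or.inr ⟨rfl, ?_⟩) (fun h => Or.inr ⟨rfl, ?_⟩)
        · exact_mod_cast h3p h
        · exact_mod_cast h5p h
    · exact false_of_coprime_factors_of_even H ha hab hbc (by omega) (by exact_mod_cast hr)
        (by exact_mod_cast hs) (Nat.isCoprime_iff_coprime.2 hcop) (by rw [hN, hrs]; push_cast; ring)
  · rcases prime_pow_or_coprime_factors (by omega : 2 ≤ M) with ⟨p, e, hp, he, hpe⟩ |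
      ⟨r, s, hr, hs, hcop, hrs⟩
    · have hpo : p % 2 = 1 := by
        rcases hp.eq_two_or_odd with rfl | h
        · rw [hpe, Nat.pow_mod, Nat.mod_self, Nat.zero_pow (by omega)] at h2
          omega
        · exact h
      have h3e : M % 3 = 0 → p = 3 := fun h => three_of hp he (by omega)
      have h5p : 5 ≤ p → 149 ≤ M := by
        intro h5
        have : M % 3 ≠ 0 := fun h => by have := h3e h; omega
        omega
      have h3p : p = 3 → 81 ≤ M := by
        rintro rfl
        have := pow_three (e := e) 3
        norm_num at this
        omega
      refine false_of_odd_prime_pow (δ := 1) H ha hab hbc hp hpo he (Or.inl rfl)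
        (by rw [hpe]; push_cast; ring) (fun h => Or.inl ⟨rfl, ?_⟩) (fun h => Or.inl ⟨rfl, ?_⟩)
      · exact_mod_cast h3p h
      · exact_mod_cast h5p h
    · exact false_of_coprime_factors_of_odd H ha hab hbc (by omega) (by omega)
        (by exact_mod_cast hr) (by exact_mod_cast hs) (Nat.isCoprime_iff_coprime.2 hcop)
        (by rw [hrs]; push_cast; ring)

/-! ### Local representations -/

/-- A quadratic map that is the identity modulo the maximal ideal is onto, by Hensel's lemma. -/
lemma PadicInt.exists_add_mul_sq_sub {p : ℕ} [Fact p.Prime] {μ : ℤ_[p]} (hμ : ‖μ‖ < 1)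
    (ν : ℤ_[p]) : ∃ x : ℤ_[p], x + μ * (x ^ 2 - x) = ν := by
  let F : Polynomial ℤ_[p] := Polynomial.C μ * Polynomial.X ^ 2 + Polynomial.C (1 - μ) *
    Polynomial.X + Polynomial.C (-ν)
  have hF : ∀ x, Polynomial.aeval x F = x + μ * (x ^ 2 - x) - ν := by
    intro x
    simp [F]
    ring
  have hF' : ∀ x, Polynomial.aeval x (Polynomial.derivative F) = 1 - μ * (1 - 2 * x) := by
    intro x
    simp [F]
    ring
  have hsmall : ∀ x : ℤ_[p], ‖μ * x‖ < 1 := by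
    intro x
    rw [norm_mul]
    exact mul_lt_one_of_nonneg_of_lt_one_left (norm_nonneg _) hμ (PadicInt.norm_le_one x)
  have hone : ‖Polynomial.aeval ν (Polynomial.derivative F)‖ = 1 := by
    rw [hF', ← PadicInt.isUnit_iff]
    refine (IsLocalRing.isUnit_or_isUnit_one_sub_self (μ * (1 - 2 * ν))).resolve_left fun h => ?_
    rw [PadicInt.isUnit_iff] at h
    exact (hsmall _).ne h
  obtain ⟨x, hx, -⟩ := hensels_lemma (F := F) (a := ν) (by
    rw [hone, hF, add_sub_cancel_left]
    simpa using hsmall _)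
  exact ⟨x, by rw [hF] at hx; exact sub_eq_zero.1 hx⟩

lemma PadicInt.isUnit_intCast_of_not_dvd {p : ℕ} [Fact p.Prime] {n : ℤ} (h : ¬ (p : ℤ) ∣ n) :
    IsUnit (n : ℤ_[p]) := by
  rw [PadicInt.isUnit_iff]
  refine le_antisymm (PadicInt.norm_le_one _) (not_lt.1 fun hlt => h ?_)
  exact PadicInt.norm_int_lt_one_iff_dvd n |>.1 hlt

/-- Representation of `g n`, in terms of the coefficients divided by `g` and permuted. -/
lemma representedOver_of_sum_eq {R K : Type*} [CommRing R] [Field K] [CharZero K] [Algebra R K]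
    {m g : ℕ} {a a' : Fin 3 → ℕ} (ha : ∀ i, a i = g * a' i) (σ : Equiv.Perm (Fin 3)) {n : ℤ}
    {x : Fin 3 → R}
    (h : ∑ j, (a' (σ j) : K) *
      (((m : K) - 2) * (algebraMap R K (x j) ^ 2 - algebraMap R K (x j)) +
      2 * algebraMap R K (x j)) = 2 * (n : K)) : RepresentedOver R K m a (g * n) := by
  refine ⟨fun i => x (σ.symm i), ?_⟩
  rw [← Equiv.sum_comp σ]
  have e : ∀ j, (a (σ j) : K) * polygonal m (algebraMap R K (x (σ.symm (σ j)))) = (g / 2 : K) *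
      ((a' (σ j) : K) * (((m : K) - 2) * (algebraMap R K (x j) ^ 2 - algebraMap R K (x j)) +
        2 * algebraMap R K (x j))) := by
    intro j
    rw [Equiv.symm_apply_apply, ha, polygonal]
    push_cast
    ring
  rw [Finset.sum_congr rfl fun j _ => e j, ← Finset.mul_sum, h]
  push_cast
  ring

/-- Points with coordinates `(w₁ - 1) / M`, `(w₂ - 1) / M`, `0`. -/
lemma representedOver_of_fractions {R K : Type*} [CommRing R] [Field K] [CharZero K] [Algebra R K]
    {m g : ℕ} {a a' : Fin 3 → ℕ} (ha : ∀ i, a i = g * a' i) (σ : Equiv.Perm (Fin 3))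
    {M w₁ w₂ n : ℤ} (hM : M = m - 2) (hM0 : M ≠ 0)
    (h : a' (σ 0) * ((w₁ - 1) * (w₁ - M + 1)) + a' (σ 1) * ((w₂ - 1) * (w₂ - M + 1)) = 2 * M * n)
    {x₁ x₂ : R} (h₁ : (M : K) * algebraMap R K x₁ = w₁ - 1)
    (h₂ : (M : K) * algebraMap R K x₂ = w₂ - 1) : RepresentedOver R K m a (g * n) := by
  refine representedOver_of_sum_eq ha σ (x := ![x₁, x₂, 0]) ?_
  have hM' : (m : K) - 2 = M := by rw [hM]; push_cast; ring
  have hK : (a' (σ 0) : K) * ((w₁ - 1) * (w₁ - M + 1)) + a' (σ 1) * ((w₂ - 1) * (w₂ - M + 1)) =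
      2 * M * n := by exact_mod_cast congrArg (Int.cast : ℤ → K) h
  have hM0' : (M : K) ≠ 0 := by exact_mod_cast hM0
  rw [Fin.sum_univ_three, hM', show (![x₁, x₂, 0] : Fin 3 → R) 0 = x₁ from rfl,
    show (![x₁, x₂, 0] : Fin 3 → R) 1 = x₂ from rfl,
    show (![x₁, x₂, 0] : Fin 3 → R) 2 = 0 from rfl, map_zero (algebraMap R K)]
  generalize algebraMap R K x₁ = y₁ at *
  generalize algebraMap R K x₂ = y₂ at *
  have e₁ : (w₁ : K) = M * y₁ + 1 := by rw [h₁]; ring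
  have e₂ : (w₂ : K) = M * y₂ + 1 := by rw [h₂]; ring
  rw [e₁, e₂] at hK
  refine mul_left_cancel₀ hM0' ?_
  linear_combination hK

/-- At a prime that divides `M`, one variable with a unit coefficient suffices; for `p = 2` this
needs `4 ∣ M`, because of the denominator of `P_m`. -/
lemma representedOver_padic_of_dvd {p m g : ℕ} [Fact p.Prime] {a a' : Fin 3 → ℕ}
    (ha : ∀ i, a i = g * a' i) {M : ℤ} (hM : M = m - 2) (n : ℤ)
    (hp : (p : ℤ) ∣ M) (h4 : p = 2 → (4 : ℤ) ∣ M) (i : Fin 3) (hi : ¬ p ∣ a' i) :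
    RepresentedOver ℤ_[p] ℚ_[p] m a (g * n) := by
  obtain ⟨μ, hμ2, hμ⟩ : ∃ μ : ℤ_[p], 2 * μ = (M : ℤ_[p]) ∧ ‖μ‖ < 1 := by
    have hsmall : ∀ x : ℤ_[p], ‖(p : ℤ_[p]) * x‖ < 1 := by
      intro x
      rw [norm_mul]
      exact mul_lt_one_of_nonneg_of_lt_one_left (norm_nonneg _)
          (by simpa using (PadicInt.norm_int_lt_one_iff_dvd (p := p) (p : ℤ)).2 dvd_rfl)
        (PadicInt.norm_le_one x)
    by_cases h2 : p = 2
    · obtain ⟨k, hk⟩ := h4 h2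
      refine ⟨p * k, ?_, hsmall _⟩
      subst h2
      rw [hk]
      push_cast
      ring
    · obtain ⟨k, hk⟩ := hp
      have hu : IsUnit ((2 : ℤ) : ℤ_[p]) := PadicInt.isUnit_intCast_of_not_dvd fun h => h2 (by
        have h' : p ∣ 2 := by exact_mod_cast h
        exact (Nat.prime_dvd_prime_iff_eq Fact.out Nat.prime_two).1 h')
      obtain ⟨v, hv⟩ := hu.exists_right_inv
      refine ⟨p * (k * v), ?_, hsmall _⟩
      rw [hk]
      push_cast at hv ⊢
      linear_combination (p : ℤ_[p]) * k * hv
  have hu : IsUnit ((a' i : ℤ) : ℤ_[p]) :=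
    PadicInt.isUnit_intCast_of_not_dvd fun h => hi (by exact_mod_cast h)
  obtain ⟨v, hv⟩ := hu.exists_right_inv
  obtain ⟨x, hx⟩ := PadicInt.exists_add_mul_sq_sub hμ (n * v)
  refine representedOver_of_sum_eq ha 1 (x := fun j => if j = i then x else 0) ?_
  have hK : (a' i : ℚ_[p]) * ((M : ℚ_[p]) * ((x : ℚ_[p]) ^ 2 - x) + 2 * x) = 2 * n := by
    have : (a' i : ℤ_[p]) * ((M : ℤ_[p]) * (x ^ 2 - x) + 2 * x) = 2 * n := by
      rw [← hμ2]
      push_cast at hv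
      linear_combination 2 * (a' i : ℤ_[p]) * hx + 2 * n * hv
    exact_mod_cast congrArg (fun z : ℤ_[p] => (z : ℚ_[p])) this
  have hM' : ((m : ℚ_[p])) - 2 = M := by rw [hM]; push_cast; ring
  rw [Finset.sum_eq_single i]
  · simpa [hM'] using hK
  · intro j _ hj
    simp [hj]
  · simp

/-- Regularity implies that the values at the points with denominator `M` are represented. -/
lemma regularAtFractions_of_isRegularForm {m g : ℕ} {a a' : Fin 3 → ℕ} (hg : 0 < g)
    (ha : ∀ i, a i = g * a' i) (hgcd : ∀ p : ℕ, p.Prime → ∃ i, ¬ p ∣ a' i)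
    (hreg : IsRegularForm m a) {M : ℤ} (hM : M = m - 2) (hM0 : M ≠ 0) (σ : Equiv.Perm (Fin 3)) :
    RegularAtFractions M (a' (σ 0)) (a' (σ 1)) (a' (σ 2)) := by
  intro w₁ w₂ n hn hodd h
  have hloc : LocallyRepresented m a (g * n) := by
    refine ⟨fun p hp => ?_, ?_⟩
    · have hcast : ∀ (y : ℤ_[p]) (N w : ℤ), (N : ℤ_[p]) * y = w →
          (N : ℚ_[p]) * algebraMap ℤ_[p] ℚ_[p] y = w := by
        intro y N w hy
        have := congrArg (fun z : ℤ_[p] => (z : ℚ_[p])) hy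
        push_cast at this
        exact this
      by_cases hpM : (p : ℤ) ∣ M
      · by_cases h42 : p = 2 ∧ ¬ (4 : ℤ) ∣ M
        · -- `M / 2` is a unit, and the numerators are even
          obtain ⟨hp2, h4⟩ := h42
          have hpM' : (2 : ℤ) ∣ M := by rw [hp2] at hpM; exact_mod_cast hpM
          have hM4 : M % 4 = 2 := by omega
          obtain ⟨⟨y₁, hy₁⟩, ⟨y₂, hy₂⟩⟩ := hodd hM4
          obtain ⟨N, hN⟩ : ∃ N, M = 2 * N := hpM'
          have hu : IsUnit (N : ℤ_[p]) := PadicInt.isUnit_intCast_of_not_dvd fun hd => by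
            have : (2 : ℤ) ∣ N := by rw [hp2] at hd; exact_mod_cast hd
            omega
          obtain ⟨v, hv⟩ := hu.exists_right_inv
          refine representedOver_of_fractions ha σ hM hM0 h (x₁ := v * y₁) (x₂ := v * y₂) ?_ ?_
          · rw [hcast (v * y₁) M (w₁ - 1) (by
              rw [hN, hy₁]; push_cast; linear_combination 2 * (y₁ : ℤ_[p]) * hv)]
            push_cast
            ring
          · rw [hcast (v * y₂) M (w₂ - 1) (by
              rw [hN, hy₂]; push_cast; linear_combination 2 * (y₂ : ℤ_[p]) * hv)]
            push_cast
            ring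
        · obtain ⟨i, hi⟩ := hgcd p hp.out
          exact representedOver_padic_of_dvd ha hM n hpM
            (fun h2 => not_not.1 fun h4 => h42 ⟨h2, h4⟩) i hi
      · obtain ⟨v, hv⟩ := (PadicInt.isUnit_intCast_of_not_dvd hpM).exists_right_inv
        refine representedOver_of_fractions ha σ hM hM0 h (x₁ := v * (w₁ - 1 : ℤ))
          (x₂ := v * (w₂ - 1 : ℤ)) ?_ ?_
        · rw [hcast _ M (w₁ - 1) (by linear_combination ((w₁ - 1 : ℤ) : ℤ_[p]) * hv)]
          push_cast
          ring
        · rw [hcast _ M (w₂ - 1) (by linear_combination ((w₂ - 1 : ℤ) : ℤ_[p]) * hv)]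
          push_cast
          ring
    · have hM0' : (M : ℝ) ≠ 0 := by exact_mod_cast hM0
      exact representedOver_of_fractions ha σ hM hM0 h (x₁ := ((w₁ : ℝ) - 1) / M)
        (x₂ := ((w₂ : ℝ) - 1) / M) (mul_div_cancel₀ _ hM0') (mul_div_cancel₀ _ hM0')
  obtain ⟨x, hx⟩ := hreg _ (by positivity) hloc
  refine ⟨x (σ 0), x (σ 1), x (σ 2), ?_⟩
  have hM' : (m : ℚ) - 2 = M := by rw [hM]; push_cast; ring
  have e : ∀ i, (a i : ℚ) * polygonal m (algebraMap ℤ ℚ (x i)) =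
      (g : ℚ) / 2 * ((a' i * gonal M (x i) : ℤ) : ℚ) := by
    intro i
    rw [ha, polygonal, gonal, show (m : ℚ) - 4 = M - 2 by rw [← hM']; ring, hM']
    simp only [algebraMap_int_eq, eq_intCast]
    push_cast
    ring
  rw [Finset.sum_congr rfl fun j _ => e j, ← Finset.mul_sum, ← Equiv.sum_comp σ,
    Fin.sum_univ_three] at hx
  have hg' : (g : ℚ) ≠ 0 := by exact_mod_cast hg.ne'
  push_cast at hx
  have hfin : (a' (σ 0) * gonal M (x (σ 0)) : ℚ) + a' (σ 1) * gonal M (x (σ 1)) +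
      a' (σ 2) * gonal M (x (σ 2)) = 2 * n := by
    refine mul_left_cancel₀ hg' ?_
    linear_combination 2 * hx
  exact_mod_cast hfin

/-- Dividing the coefficients of a regular ternary form by their greatest common divisor and sorting
them yields coefficients that are regular at the points with denominator `M`. -/
lemma exists_regularAtFractions {m : ℕ} {a : Fin 3 → ℕ} (ha : ∀ i, 0 < a i)
    (hreg : IsRegularForm m a) {M : ℤ} (hM : M = m - 2) (hM0 : M ≠ 0) :
    ∃ b₁ b₂ b₃ : ℤ, 0 < b₁ ∧ b₁ ≤ b₂ ∧ b₂ ≤ b₃ ∧ RegularAtFractions M b₁ b₂ b₃ := by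
  obtain ⟨a', ha', hgcd⟩ := Finset.extract_gcd a (s := Finset.univ) ⟨0, Finset.mem_univ _⟩
  have haa : ∀ i, a i = Finset.univ.gcd a * a' i := fun i => ha' i (Finset.mem_univ _)
  have hpos : ∀ i, 0 < Finset.univ.gcd a ∧ 0 < a' i := fun i => by
    have := ha i
    rw [haa i] at this
    exact ⟨Nat.pos_of_mul_pos_right this, Nat.pos_of_mul_pos_left this⟩
  have hmono := Tuple.monotone_sort a'
  refine ⟨a' (Tuple.sort a' 0), a' (Tuple.sort a' 1), a' (Tuple.sort a' 2),
    by exact_mod_cast (hpos _).2, by exact_mod_cast hmono (by decide : (0 : Fin 3) ≤ 1),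
    by exact_mod_cast hmono (by decide : (1 : Fin 3) ≤ 2),
    regularAtFractions_of_isRegularForm (hpos 0).1 haa (fun p hp => ?_) hreg hM hM0 _⟩
  by_contra hall
  push Not at hall
  have : p ∣ Finset.univ.gcd a' := Finset.dvd_gcd fun i _ => hall i
  rw [hgcd] at this
  exact hp.one_lt.ne' (Nat.dvd_one.1 this)

/-! ### The bounds -/

theorem theorem1p1 (m : ℕ) (hm : 3 ≤ m)
    (h : ∃ a : Fin 3 → ℕ, (∀ i, 0 < a i) ∧ IsRegularForm m a) :
    (m % 2 = 1 → m % 3 = 2 → m ≤ 35) ∧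
    (m % 2 = 1 → m % 3 ≠ 2 → m ≤ 147) ∧
    (m % 4 = 2 → m % 3 = 2 → m ≤ 38) ∧
    (m % 4 = 2 → m % 3 ≠ 2 → m ≤ 142) ∧
    (m % 4 = 0 → m % 3 = 2 → m ≤ 188) ∧
    (m % 4 = 0 → m % 3 ≠ 2 → m ≤ 712) := by
  obtain ⟨a, ha, hreg⟩ := h
  obtain ⟨M, rfl⟩ : ∃ M, m = M + 2 := ⟨m - 2, by omega⟩
  obtain ⟨b₁, b₂, b₃, h0, h1, h2, H⟩ := exists_regularAtFractions (M := M) ha hreg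
    (by push_cast; ring) (by omega)
  have key := false_of_large H h0 h1 h2
  refine ⟨?_, ?_, ?_, ?_, ?_, ?_⟩ <;>
    exact fun e1 e2 => not_lt.1 fun hlt => key (by omega)
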